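/- Let $M$ be a smooth manifold of dimension $n$, let $\alpha=\sqrt{a_{ij}(x)y^iy^j}$ be a smooth (positive definite) Riemannian metric and $\beta=b_i(x)y^i$ a smooth $1$-form on $M$, and let $F=\alpha^2/\beta$ be the associated Kropina metric, considered on the domain of the tangent bundle where $\beta>0$. For a Finsler metric $F$, in the natural coordinates $(x^i,y^i)$ of a chart, put $g_{ij}=\frac12[F^2]_{y^iy^j}$, $(g^{ij})=(g_{ij})^{-1}$, $$G^i=\tfrac14 g^{il}\{[F^2]_{x^ky^l}y^k-[F^2]_{x^l}\},$$ $$R^i{}_k=2\frac{\partial G^i}{\partial x^k}-\frac{\partial^2G^i}{\partial x^m\partial y^k}y^m+2G^m\frac{\partial^2G^i}{\partial y^m\partial y^k}-\frac{\partial G^i}{\partial y^m}\frac{\partial G^m}{\partial y^k},\qquad \mathrm{Ric}=R^m{}_m .$$ Let $\mathrm{Ric}$ and $\overline{\mathrm{Ric}}$ be the Ricci curvatures of $F$ and of $\alpha$. Let "$|$" denote the covariant derivative with respect to the Levi-Civita connection of $\alpha$, and let $$r_{ij}=\tfrac12(b_{i|j}+b_{j|i}),\qquad s_{ij}=\tfrac12(b_{i|j}-b_{j|i}),$$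 $(a^{ij})=(a_{ij})^{-1}$, $b^i=a^{ij}b_j$, $b^2=b^ib_i$, $b^4=(b^2)^2$, $r^i{}_j=a^{ik}r_{kj}$, $s^i{}_j=a^{ik}s_{kj}$, $r_j=b^ir_{ij}$, $s_j=b^is_{ij}$, $r=b^jr_j$, $s^i=a^{ij}s_j$. An index $0$ denotes contraction with $y$ (of the tensor, after any covariant differentiation): $r_{00}=r_{ij}y^iy^j$, $r_{0k}=r_{jk}y^j$, $r_0=r_iy^i$, $s_0=s_iy^i$, $s^k{}_0=s^k{}_jy^j$, $r_{00|k}=r_{ij|k}y^iy^j$, $r_{00|0}=r_{ij|k}y^iy^jy^k$, $r_{0|0}=r_{i|k}y^iy^k$, $s_{0|k}=s_{i|k}y^i$, $s_{0|0}=s_{i|k}y^iy^k$, $s^k{}_{0|k}=s^k{}_{j|k}y^j$. Then, in every chart of $M$ and at every $(x,y)$ with $\beta(x,y)>0$, $$\mathrm{Ric}=\overline{\mathrm{Ric}}+T,$$ where $$\begin{aligned} T={}&-\frac{\alpha^2}{b^4\beta}s_0r-\frac{r}{b^4}r_{00}+\frac{\alpha^2}{b^2\beta}b^ks_{0|k}+\frac1{b^2}b^kr_{00|k}+\frac{n-2}{b^2}s_{0|0}+\frac{n-1}{b^2\alpha^2}\beta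 r_{00|0}+\frac1{b^2}\Big(\frac{\alpha^2}{\beta}s_0+r_{00}\Big)r^k{}_k\\ &-\frac{\alpha^2}{\beta}s^k{}_{0|k}-\frac1{b^2}r_{0|0}-\frac{2(2n-3)}{b^4}r_0s_0-\frac{n-2}{b^4}s_0^2-\frac{4(n-1)}{b^4\alpha^2}\beta r_{00}r_0+\frac{2(n-1)}{b^4\alpha^2}\beta r_{00}s_0\\ &+\frac{3(n-1)}{b^4\alpha^4}\beta^2r_{00}^2+\frac{2n}{b^2}s^k{}_0r_{0k}+\frac1{b^4}r_0^2-\frac{\alpha^2}{b^2\beta}s^k{}_0r_k+\frac{n-1}{b^2\beta}\alpha^2s^k{}_0s_k-\frac{\alpha^4}{2b^2\beta^2}s^ks_k-\frac{\alpha^2}{b^2\beta}s^kr_{0k}\\ &-\frac{\alpha^4}{4\beta^2}s^j{}_ks^k{}_j . \end{aligned}$$ -/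

import Mathlib

open scoped Manifold ContDiff

noncomputable section

namespace Finsler

/-- The coordinate space `ℝⁿ`. -/
abbrev Coord (n : ℕ) := EuclideanSpace ℝ (Fin n)

/-- The `k`-th coordinate vector of `ℝⁿ`. -/
abbrev unitVec {n : ℕ} (k : Fin n) : Coord n := EuclideanSpace.single k 1

/-- `∂f/∂xᵏ` for a function `f` of the position `x`. -/
def pd {n : ℕ} (k : Fin n) (f : Coord n → ℝ) (x : Coord n) : ℝ :=
  fderiv ℝ f x (unitVec k)

/-- `∂f/∂xᵏ` for a function `f` of position `x` and direction `y`. -/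
def pdX {n : ℕ} (k : Fin n) (f : Coord n → Coord n → ℝ) : Coord n → Coord n → ℝ :=
  fun x y => pd k (fun z => f z y) x

/-- `∂f/∂yᵏ` for a function `f` of position `x` and direction `y`. -/
def pdY {n : ℕ} (k : Fin n) (f : Coord n → Coord n → ℝ) : Coord n → Coord n → ℝ :=
  fun x y => pd k (fun w => f x w) y

/-- The square `F²`. -/
def energy {n : ℕ} (F : Coord n → Coord n → ℝ) : Coord n → Coord n → ℝ :=
  fun x y => F x y ^ 2

/-- The fundamental tensor `g_{ij} = ½ [F²]_{yⁱyʲ}`. -/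
def fundamentalTensor {n : ℕ} (F : Coord n → Coord n → ℝ) (x y : Coord n) :
    Matrix (Fin n) (Fin n) ℝ :=
  Matrix.of fun i j => (1 / 2) * pdY j (pdY i (energy F)) x y

/-- The geodesic coefficients `Gⁱ = ¼ gⁱˡ ([F²]_{xᵏyˡ} yᵏ - [F²]_{xˡ})`. -/
def geodesicCoeff {n : ℕ} (F : Coord n → Coord n → ℝ) (i : Fin n) : Coord n → Coord n → ℝ :=
  fun x y => (1 / 4) * ∑ l, (fundamentalTensor F x y)⁻¹ i l *
    ((∑ k, pdY l (pdX k (energy F)) x y * y k) - pdX l (energy F) x y)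

/-- The Riemann curvature `Rⁱ_k` of a Finsler metric, in natural coordinates. -/
def riemannCurvature {n : ℕ} (F : Coord n → Coord n → ℝ) (i k : Fin n) (x y : Coord n) : ℝ :=
  2 * pdX k (geodesicCoeff F i) x y
    - (∑ m, pdX m (pdY k (geodesicCoeff F i)) x y * y m)
    + 2 * (∑ m, geodesicCoeff F m x y * pdY m (pdY k (geodesicCoeff F i)) x y)
    - ∑ m, pdY m (geodesicCoeff F i) x y * pdY k (geodesicCoeff F m) x y

/-- The Ricci curvature `Ric = Rᵐ_m` of a Finsler metric, in natural coordinates. -/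
def ricci {n : ℕ} (F : Coord n → Coord n → ℝ) (x y : Coord n) : ℝ :=
  ∑ m, riemannCurvature F m m x y

section Tensors

/-! Tensor calculus of a Riemannian metric `a = (a_{ij})` and a `1`-form `b = (b_i)` given
in coordinates. The index of a derivative (the one after the bar) always comes last. -/

variable {n : ℕ} (a : Coord n → Matrix (Fin n) (Fin n) ℝ) (b : Coord n → Fin n → ℝ)

/-- Christoffel symbols `Γᵏ_{ij}` of the Levi-Civita connection of `a`. -/
def christoffel (k i j : Fin n) (x : Coord n) : ℝ :=
  (1 / 2) * ∑ l, (a x)⁻¹ k l *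
    (pd i (fun z => a z j l) x + pd j (fun z => a z i l) x - pd l (fun z => a z i j) x)

/-- `w_{i|k}` for a covector field `w_i`. -/
def covCovector (w : Fin n → Coord n → ℝ) (i k : Fin n) (x : Coord n) : ℝ :=
  pd k (w i) x - ∑ m, christoffel a m i k x * w m x

/-- `t_{ij|k}` for a tensor field `t_{ij}`. -/
def covTwo (t : Fin n → Fin n → Coord n → ℝ) (i j k : Fin n) (x : Coord n) : ℝ :=
  pd k (t i j) x - (∑ m, christoffel a m i k x * t m j x)
    - ∑ m, christoffel a m j k x * t i m x

/-- `tⁱ_{j|k}` for a tensor field `tⁱ_j`. -/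
def covMixed (t : Fin n → Fin n → Coord n → ℝ) (i j k : Fin n) (x : Coord n) : ℝ :=
  pd k (t i j) x + (∑ m, christoffel a i m k x * t m j x)
    - ∑ m, christoffel a m j k x * t i m x

/-- `b_{i|j}` -/
def db (i j : Fin n) (x : Coord n) : ℝ := covCovector a (fun i z => b z i) i j x

/-- `bⁱ = aⁱʲ b_j` -/
def bUp (i : Fin n) (x : Coord n) : ℝ := ∑ j, (a x)⁻¹ i j * b x j

/-- `b² = bⁱ b_i`, the squared length of `b` with respect to `a` -/
def bSq (x : Coord n) : ℝ := ∑ i, bUp a b i x * b x i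

/-- `r_{ij} = ½ (b_{i|j} + b_{j|i})` -/
def r (i j : Fin n) (x : Coord n) : ℝ := (1 / 2) * (db a b i j x + db a b j i x)

/-- `s_{ij} = ½ (b_{i|j} - b_{j|i})` -/
def s (i j : Fin n) (x : Coord n) : ℝ := (1 / 2) * (db a b i j x - db a b j i x)

/-- `sⁱ_j = aⁱᵏ s_{kj}` -/
def sMixed (i j : Fin n) (x : Coord n) : ℝ := ∑ k, (a x)⁻¹ i k * s a b k j x

/-- `rᵏ_k = aᵏʲ r_{jk}` -/
def rTrace (x : Coord n) : ℝ := ∑ k, ∑ j, (a x)⁻¹ k j * r a b j k x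

/-- `r_j = bⁱ r_{ij}` -/
def rLow (j : Fin n) (x : Coord n) : ℝ := ∑ i, bUp a b i x * r a b i j x

/-- `s_j = bⁱ s_{ij}` -/
def sLow (j : Fin n) (x : Coord n) : ℝ := ∑ i, bUp a b i x * s a b i j x

/-- `sⁱ = aⁱʲ s_j` -/
def sUp (i : Fin n) (x : Coord n) : ℝ := ∑ j, (a x)⁻¹ i j * sLow a b j x

/-- the scalar `r = r_{ij} bⁱ bʲ` -/
def rScalar (x : Coord n) : ℝ := ∑ j, bUp a b j x * rLow a b j x

/-- `α² = a_{ij} yⁱ yʲ` -/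
def alphaSq (x y : Coord n) : ℝ := ∑ i, ∑ j, a x i j * y i * y j

/-- `β = b_i yⁱ` -/
def beta (x y : Coord n) : ℝ := ∑ i, b x i * y i

/-- `r_{00} = r_{ij} yⁱ yʲ` -/
def r00 (x y : Coord n) : ℝ := ∑ i, ∑ j, r a b i j x * y i * y j

/-- `r_{0k} = r_{jk} yʲ` -/
def r0k (k : Fin n) (x y : Coord n) : ℝ := ∑ j, r a b j k x * y j

/-- `r_0 = r_i yⁱ` -/
def r0 (x y : Coord n) : ℝ := ∑ i, rLow a b i x * y i

/-- `s_0 = s_i yⁱ` -/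
def s0 (x y : Coord n) : ℝ := ∑ i, sLow a b i x * y i

/-- `sᵏ_0 = sᵏ_j yʲ` -/
def sMixed0 (k : Fin n) (x y : Coord n) : ℝ := ∑ j, sMixed a b k j x * y j

/-- `r_{00|k} = r_{ij|k} yⁱ yʲ` -/
def r00Cov (k : Fin n) (x y : Coord n) : ℝ := ∑ i, ∑ j, covTwo a (r a b) i j k x * y i * y j

/-- `r_{0|k} = r_{i|k} yⁱ` -/
def r0Cov (k : Fin n) (x y : Coord n) : ℝ := ∑ i, covCovector a (rLow a b) i k x * y i

/-- `s_{0|k} = s_{i|k} yⁱ` -/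
def s0Cov (k : Fin n) (x y : Coord n) : ℝ := ∑ i, covCovector a (sLow a b) i k x * y i

/-- `sᵏ_{0|k} = sᵏ_{j|k} yʲ` -/
def sDiv0 (x y : Coord n) : ℝ := ∑ k, ∑ j, covMixed a (sMixed a b) k j k x * y j

/-- The difference `T` between the Ricci curvatures of `α²/β` and of `α`. -/
def kropinaT (x y : Coord n) : ℝ :=
  let N : ℝ := n
  let A : ℝ := alphaSq a x y
  let B : ℝ := beta b x y
  let b2 : ℝ := bSq a b x
  let b4 : ℝ := b2 ^ 2
  let ρ00 : ℝ := r00 a b x y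
  let ρ0 : ℝ := r0 a b x y
  let ρ : ℝ := rScalar a b x
  let σ0 : ℝ := s0 a b x y;
  -(A / (b4 * B)) * σ0 * ρ
  - ρ / b4 * ρ00
  + A / (b2 * B) * (∑ k, bUp a b k x * s0Cov a b k x y)
  + 1 / b2 * (∑ k, bUp a b k x * r00Cov a b k x y)
  + (N - 2) / b2 * (∑ k, s0Cov a b k x y * y k)
  + (N - 1) / (b2 * A) * B * (∑ k, r00Cov a b k x y * y k)
  + 1 / b2 * (A / B * σ0 + ρ00) * rTrace a b x
  - A / B * sDiv0 a b x y
  - 1 / b2 * (∑ k, r0Cov a b k x y * y k)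
  - 2 * (2 * N - 3) / b4 * ρ0 * σ0
  - (N - 2) / b4 * σ0 ^ 2
  - 4 * (N - 1) / (b4 * A) * B * ρ00 * ρ0
  + 2 * (N - 1) / (b4 * A) * B * ρ00 * σ0
  + 3 * (N - 1) / (b4 * A ^ 2) * B ^ 2 * ρ00 ^ 2
  + 2 * N / b2 * (∑ k, sMixed0 a b k x y * r0k a b k x y)
  + 1 / b4 * ρ0 ^ 2
  - A / (b2 * B) * (∑ k, sMixed0 a b k x y * rLow a b k x)
  + (N - 1) / (b2 * B) * A * (∑ k, sMixed0 a b k x y * sLow a b k x)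
  - A ^ 2 / (2 * b2 * B ^ 2) * (∑ k, sUp a b k x * sLow a b k x)
  - A / (b2 * B) * (∑ k, sUp a b k x * r0k a b k x y)
  - A ^ 2 / (4 * B ^ 2) * (∑ j, ∑ k, sMixed a b j k x * sMixed a b k j x)

end Tensors

section Manifold

variable {n : ℕ} {M : Type*} [TopologicalSpace M] [ChartedSpace (Coord n) M]

/-- A smooth Riemannian metric on the manifold `M`. -/
abbrev SmoothMetric (n : ℕ) (M : Type*) [TopologicalSpace M] [ChartedSpace (Coord n) M]
    [IsManifold (𝓡 n) ∞ M] :=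
  Bundle.ContMDiffRiemannianMetric (𝓡 n) ∞ (Coord n) (TangentSpace (𝓡 n) : M → Type)

/-- The tangent vector `yⁱ ∂/∂xⁱ` at the point with coordinates `x` in the chart `e`. -/
def chartVec (e : OpenPartialHomeomorph M (Coord n)) (x y : Coord n) :
    TangentSpace (𝓡 n) (e.symm x) :=
  mfderiv (𝓡 n) (𝓡 n) e.symm x y

/-- A function on the tangent bundle, expressed in the natural coordinates `(xⁱ, yⁱ)` that
the chart `e` induces. -/
def inChart (e : OpenPartialHomeomorph M (Coord n))
    (F : (p : M) → TangentSpace (𝓡 n) p → ℝ) (x y : Coord n) : ℝ :=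
  F (e.symm x) (chartVec e x y)

/-- The components `a_{ij}` of a Riemannian metric in a chart. -/
def metricComp [IsManifold (𝓡 n) ∞ M] (e : OpenPartialHomeomorph M (Coord n))
    (g : SmoothMetric n M) (x : Coord n) : Matrix (Fin n) (Fin n) ℝ :=
  Matrix.of fun i j =>
    g.inner (e.symm x) (chartVec e x (unitVec i)) (chartVec e x (unitVec j))

/-- The components `b_i` of a `1`-form in a chart. -/
def formComp (e : OpenPartialHomeomorph M (Coord n))
    (β : (p : M) → TangentSpace (𝓡 n) p →L[ℝ] ℝ) (x : Coord n) (i : Fin n) : ℝ :=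
  β (e.symm x) (chartVec e x (unitVec i))

/-- The Riemannian norm `α` on tangent vectors. -/
def riemannianNorm [IsManifold (𝓡 n) ∞ M] (g : SmoothMetric n M) (p : M)
    (v : TangentSpace (𝓡 n) p) : ℝ :=
  √(g.inner p v v)

/-- The Kropina metric `F = α² / β`; it is considered only where `β > 0`. -/
def kropinaMetric [IsManifold (𝓡 n) ∞ M] (g : SmoothMetric n M)
    (β : (p : M) → TangentSpace (𝓡 n) p →L[ℝ] ℝ) (p : M) (v : TangentSpace (𝓡 n) p) : ℝ :=
  riemannianNorm g p v ^ 2 / β p v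

end Manifold

end Finsler

end

/-! The Ricci curvature sees a Finsler metric only through its geodesic coefficients. For `α` these
are `½ Γⁱ_{jk} yʲ yᵏ`; for `α²/β` they differ from them by `Hⁱ = P bⁱ - C sⁱ_0 - Q yⁱ`, where `P =
(α² s_0/β + r_00)/(2b²)`, `C = α²/(2β)`, `Q = (s_0 + β r_00/α²)/b²`. The fundamental tensor is never
inverted: where `β > 0` it is positive definite (`kropinaTensor_pos`), so its linear system has only
one solution, and `kropinaTensor_mulVec_kropinaH` carries the check that the proposed coefficients
solve it.

To compare the two curvatures, `∂/∂xᵏ` is split as `δ_k + Nᵐ_k ∂/∂yᵐ` with `Nᵐ_k = Γᵐ_{lk} yˡ`. On a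
tensor fully contracted with `y`, the horizontal derivative `δ_k` is the covariant derivative; in
particular it kills `α²`. In this frame every non-tensorial term cancels, and with `D = ∂Hⁱ/∂yⁱ` the
difference of the Ricci curvatures is `2 Hⁱ_{|i} - D_{|k} yᵏ + 2 Hᵐ ∂D/∂yᵐ - (∂Hⁱ/∂yᵐ)(∂Hᵐ/∂yⁱ)`
(`sprayRicci_add`). The curvature of `α` itself is never computed.

What is left is algebra. The matrix `∂Hⁱ/∂yᵐ` is a combination of three rank-one matrices, `sⁱ_m`
and the identity, so the trace of its square consists of dot products, `sᵏ_m sᵐ_k` and the dimension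
(`sum_sum_mul_swap`). A table of contractions of `y`, `b`, `r`, `s` turns everything into scalars,
and `kropinaT_eq` becomes an identity of rational functions. On the manifold it remains to see that
the components in a chart form a smooth metric and a smooth `1`-form. -/

noncomputable section

namespace Finsler

/-! ### Directional derivatives on position-direction space -/

section Calculus

variable {n : ℕ}

/-- `f` is differentiable at `p` and its derivative in the direction `v` is `d`. -/
def HasD (f : Coord n × Coord n → ℝ) (p v : Coord n × Coord n) (d : ℝ) : Prop :=
  DifferentiableAt ℝ f p ∧ fderiv ℝ f p v = d

namespace HasD

variable {f g : Coord n × Coord n → ℝ} {p v : Coord n × Coord n} {d e : ℝ}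

/-- The product and quotient rules yield an unsimplified value; this replaces it by the intended
one, so each derivative computation ends in an algebraic identity. -/
lemma congr_val (h : HasD f p v d) (hd : d = e) : HasD f p v e := hd ▸ h

lemma const (c : ℝ) : HasD (fun _ => c) p v 0 := by
  refine ⟨differentiableAt_const c, ?_⟩
  simp

lemma add (hf : HasD f p v d) (hg : HasD g p v e) : HasD (fun q => f q + g q) p v (d + e) := by
  refine ⟨hf.1.add hg.1, ?_⟩
  rw [fderiv_fun_add hf.1 hg.1, _root_.add_apply, hf.2, hg.2]

lemma sub (hf : HasD f p v d) (hg : HasD g p v e) : HasD (fun q => f q - g q) p v (d - e) := by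
  refine ⟨hf.1.sub hg.1, ?_⟩
  rw [fderiv_fun_sub hf.1 hg.1, _root_.sub_apply, hf.2, hg.2]

lemma mul (hf : HasD f p v d) (hg : HasD g p v e) :
    HasD (fun q => f q * g q) p v (d * g p + f p * e) := by
  refine ⟨hf.1.mul hg.1, ?_⟩
  rw [fderiv_fun_mul hf.1 hg.1]
  simp [hf.2, hg.2]
  ring

lemma const_mul (c : ℝ) (hf : HasD f p v d) : HasD (fun q => c * f q) p v (c * d) :=
  ((const c).mul hf).congr_val (by ring)

lemma div (hf : HasD f p v d) (hg : HasD g p v e) (h0 : g p ≠ 0) :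
    HasD (fun q => f q / g q) p v (d / g p - f p * e / g p ^ 2) := by
  have h' : HasFDerivAt (fun q => f q * (g q)⁻¹) _ p :=
    hf.1.hasFDerivAt.fun_mul ((hasDerivAt_inv h0).comp_hasFDerivAt p hg.1.hasFDerivAt)
  simp only [← div_eq_mul_inv] at h'
  refine ⟨h'.differentiableAt, ?_⟩
  rw [h'.fderiv]
  simp [hf.2, hg.2]
  field_simp
  ring

lemma sum {ι : Type*} {s : Finset ι} {f : ι → Coord n × Coord n → ℝ} {d : ι → ℝ}
    (h : ∀ i ∈ s, HasD (f i) p v (d i)) :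
    HasD (fun q => ∑ i ∈ s, f i q) p v (∑ i ∈ s, d i) := by
  refine ⟨DifferentiableAt.fun_sum fun i hi => (h i hi).1, ?_⟩
  rw [fderiv_fun_sum fun i hi => (h i hi).1, _root_.sum_apply]
  exact Finset.sum_congr rfl fun i hi => (h i hi).2

/-- A function of the position only. -/
lemma of_fst {f : Coord n → ℝ} (h : DifferentiableAt ℝ f p.1) :
    HasD (fun q => f q.1) p v (fderiv ℝ f p.1 v.1) := by
  have h' : HasFDerivAt (fun q : Coord n × Coord n => f q.1) _ p :=
    h.hasFDerivAt.comp p (hasFDerivAt_fst (p := p))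
  exact ⟨h'.differentiableAt, by rw [h'.fderiv]; simp⟩

/-- A coordinate of the direction. -/
lemma coord_snd (i : Fin n) : HasD (fun q => q.2 i) p v (v.2 i) := by
  have h' : HasFDerivAt (fun q : Coord n × Coord n => q.2 i)
      ((EuclideanSpace.proj i : Coord n →L[ℝ] ℝ).comp (ContinuousLinearMap.snd ℝ _ _)) p :=
    (((EuclideanSpace.proj i : Coord n →L[ℝ] ℝ).comp
      (ContinuousLinearMap.snd ℝ (Coord n) (Coord n))).hasFDerivAt)
  exact ⟨h'.differentiableAt, by rw [h'.fderiv]; simp⟩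

end HasD

/-- Joint differentiability makes a partial derivative the value of one linear map on a vector of
the product space. That vector can then be decomposed into horizontal and vertical parts. -/
lemma pdX_eq_fderiv {f : Coord n → Coord n → ℝ} {x y : Coord n} (k : Fin n)
    (h : DifferentiableAt ℝ (Function.uncurry f) (x, y)) :
    pdX k f x y = fderiv ℝ (Function.uncurry f) (x, y) (unitVec k, 0) := by
  have h' : HasFDerivAt (fun z => f z y)
      ((fderiv ℝ (Function.uncurry f) (x, y)).comp (ContinuousLinearMap.inl ℝ _ _)) x :=
    HasFDerivAt.comp (g := Function.uncurry f) (f := fun z => (z, y)) x h.hasFDerivAt (hasFDerivAt_prodMk_left x y)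
  simp [pdX, pd, h'.fderiv]

lemma pdY_eq_fderiv {f : Coord n → Coord n → ℝ} {x y : Coord n} (k : Fin n)
    (h : DifferentiableAt ℝ (Function.uncurry f) (x, y)) :
    pdY k f x y = fderiv ℝ (Function.uncurry f) (x, y) (0, unitVec k) := by
  have h' : HasFDerivAt (fun z => f x z)
      ((fderiv ℝ (Function.uncurry f) (x, y)).comp (ContinuousLinearMap.inr ℝ _ _)) y :=
    HasFDerivAt.comp (g := Function.uncurry f) (f := fun z => (x, z)) y h.hasFDerivAt (hasFDerivAt_prodMk_right x y)
  simp [pdY, pd, h'.fderiv]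

lemma HasD.pdX {f : Coord n → Coord n → ℝ} {x y : Coord n} {k : Fin n} {d : ℝ}
    (h : HasD (fun q => f q.1 q.2) (x, y) (unitVec k, 0) d) : pdX k f x y = d :=
  (pdX_eq_fderiv k h.1).trans h.2

lemma HasD.pdY {f : Coord n → Coord n → ℝ} {x y : Coord n} {k : Fin n} {d : ℝ}
    (h : HasD (fun q => f q.1 q.2) (x, y) (0, unitVec k) d) : pdY k f x y = d :=
  (pdY_eq_fderiv k h.1).trans h.2

variable {W : Set (Coord n × Coord n)}

/-- The formulas to be differentiated hold only where `β > 0`; openness of that set lets them be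
differentiated there. -/
lemma pdX_congr (hW : IsOpen W) {f g : Coord n → Coord n → ℝ}
    (h : ∀ x y, (x, y) ∈ W → f x y = g x y) (k : Fin n) {x y : Coord n} (hp : (x, y) ∈ W) :
    pdX k f x y = pdX k g x y := by
  have : (fun z => f z y) =ᶠ[nhds x] fun z => g z y := by
    have hc : Continuous fun z : Coord n => (z, y) := by fun_prop
    filter_upwards [(hW.preimage hc).mem_nhds hp] with z hz using h z y hz
  simp [pdX, pd, this.fderiv_eq]

lemma pdY_congr (hW : IsOpen W) {f g : Coord n → Coord n → ℝ}
    (h : ∀ x y, (x, y) ∈ W → f x y = g x y) (k : Fin n) {x y : Coord n} (hp : (x, y) ∈ W) :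
    pdY k f x y = pdY k g x y := by
  have : (fun z => f x z) =ᶠ[nhds y] fun z => g x z := by
    have hc : Continuous fun z : Coord n => (x, z) := by fun_prop
    filter_upwards [(hW.preimage hc).mem_nhds hp] with z hz using h x z hz
  simp [pdY, pd, this.fderiv_eq]

/-- Joint smoothness on `W` of a function of position and direction. -/
def SmoothOn (W : Set (Coord n × Coord n)) (f : Coord n → Coord n → ℝ) : Prop :=
  ContDiffOn ℝ ∞ (Function.uncurry f) W

lemma SmoothOn.differentiableAt (hW : IsOpen W) {f : Coord n → Coord n → ℝ} (hf : SmoothOn W f)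
    {x y : Coord n} (hp : (x, y) ∈ W) : DifferentiableAt ℝ (Function.uncurry f) (x, y) :=
  (hf.contDiffAt (hW.mem_nhds hp)).differentiableAt (by simp)

lemma SmoothOn.fderiv_apply (hW : IsOpen W) {f : Coord n → Coord n → ℝ} (hf : SmoothOn W f)
    (v : Coord n × Coord n) :
    ContDiffOn ℝ ∞ (fun p => fderiv ℝ (Function.uncurry f) p v) W :=
  (hf.fderiv_of_isOpen hW (by simp)).clm_apply contDiffOn_const

lemma SmoothOn.pdX (hW : IsOpen W) {f : Coord n → Coord n → ℝ} (hf : SmoothOn W f) (k : Fin n) :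
    SmoothOn W (pdX k f) :=
  (hf.fderiv_apply hW (unitVec k, 0)).congr fun ⟨_, _⟩ hp =>
    pdX_eq_fderiv k (hf.differentiableAt hW hp)

lemma SmoothOn.pdY (hW : IsOpen W) {f : Coord n → Coord n → ℝ} (hf : SmoothOn W f) (k : Fin n) :
    SmoothOn W (pdY k f) :=
  (hf.fderiv_apply hW (0, unitVec k)).congr fun ⟨_, _⟩ hp =>
    pdY_eq_fderiv k (hf.differentiableAt hW hp)

/-- Symmetry of the second derivative. It allows `[F²]_{xᵏyˡ}` to be found as an `x`-derivative of
the vertical gradient, which is known in closed form. -/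
lemma pdY_pdX_comm (hW : IsOpen W) {f : Coord n → Coord n → ℝ} (hf : SmoothOn W f) (k l : Fin n)
    {x y : Coord n} (hp : (x, y) ∈ W) : pdY l (pdX k f) x y = pdX k (pdY l f) x y := by
  have hfd : DifferentiableAt ℝ (fderiv ℝ (Function.uncurry f)) (x, y) :=
    ((hf.fderiv_of_isOpen hW (m := ∞) (by simp)).contDiffAt
      (hW.mem_nhds hp)).differentiableAt (by simp)
  have key : ∀ v w : Coord n × Coord n,
      fderiv ℝ (fun p => fderiv ℝ (Function.uncurry f) p v) (x, y) w
        = fderiv ℝ (fderiv ℝ (Function.uncurry f)) (x, y) w v := by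
    intro v w
    rw [fderiv_clm_apply hfd (differentiableAt_const v)]
    simp
  have hsymm := (hf.contDiffAt (hW.mem_nhds hp)).isSymmSndFDerivAt
    (by simp only [minSmoothness_of_isRCLikeNormedField]; exact WithTop.coe_le_coe.2 le_top)
  rw [pdY_eq_fderiv l ((hf.pdX hW k).differentiableAt hW hp),
    pdX_eq_fderiv k ((hf.pdY hW l).differentiableAt hW hp)]
  have e1 : Function.uncurry (Finsler.pdX k f) =ᶠ[nhds (x, y)]
      fun p => fderiv ℝ (Function.uncurry f) p (unitVec k, 0) := by
    filter_upwards [hW.mem_nhds hp] with q hq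
    exact pdX_eq_fderiv k (hf.differentiableAt hW hq)
  have e2 : Function.uncurry (Finsler.pdY l f) =ᶠ[nhds (x, y)]
      fun p => fderiv ℝ (Function.uncurry f) p (0, unitVec l) := by
    filter_upwards [hW.mem_nhds hp] with q hq
    exact pdY_eq_fderiv l (hf.differentiableAt hW hq)
  rw [e1.fderiv_eq, e2.fderiv_eq, key, key]
  exact hsymm _ _

lemma pdX_add {f g : Coord n → Coord n → ℝ} {x y : Coord n} (k : Fin n)
    (hf : DifferentiableAt ℝ (Function.uncurry f) (x, y))
    (hg : DifferentiableAt ℝ (Function.uncurry g) (x, y)) :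
    pdX k (fun x y => f x y + g x y) x y = pdX k f x y + pdX k g x y := by
  rw [pdX_eq_fderiv k hf, pdX_eq_fderiv k hg]
  exact HasD.pdX (HasD.add ⟨hf, rfl⟩ ⟨hg, rfl⟩)

lemma pdY_add {f g : Coord n → Coord n → ℝ} {x y : Coord n} (k : Fin n)
    (hf : DifferentiableAt ℝ (Function.uncurry f) (x, y))
    (hg : DifferentiableAt ℝ (Function.uncurry g) (x, y)) :
    pdY k (fun x y => f x y + g x y) x y = pdY k f x y + pdY k g x y := by
  rw [pdY_eq_fderiv k hf, pdY_eq_fderiv k hg]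
  exact HasD.pdY (HasD.add ⟨hf, rfl⟩ ⟨hg, rfl⟩)

lemma pdX_sum {f : Fin n → Coord n → Coord n → ℝ} {x y : Coord n} (k : Fin n)
    (hf : ∀ i, DifferentiableAt ℝ (Function.uncurry (f i)) (x, y)) :
    pdX k (fun x y => ∑ i, f i x y) x y = ∑ i, pdX k (f i) x y := by
  simp_rw [pdX_eq_fderiv k (hf _)]
  exact HasD.pdX (HasD.sum fun i _ => ⟨hf i, rfl⟩)

lemma pdY_sum {f : Fin n → Coord n → Coord n → ℝ} {x y : Coord n} (k : Fin n)
    (hf : ∀ i, DifferentiableAt ℝ (Function.uncurry (f i)) (x, y)) :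
    pdY k (fun x y => ∑ i, f i x y) x y = ∑ i, pdY k (f i) x y := by
  simp_rw [pdY_eq_fderiv k (hf _)]
  exact HasD.pdY (HasD.sum fun i _ => ⟨hf i, rfl⟩)

end Calculus

/-! ### Ricci curvature of a spray -/

section Spray

variable {n : ℕ} {W : Set (Coord n × Coord n)}

/-- The divergence of a spray in the direction variables. -/
def vdiv (X : Fin n → Coord n → Coord n → ℝ) (x y : Coord n) : ℝ := ∑ i, pdY i (X i) x y

/-- The Ricci curvature of the spray with coefficients `X`. -/
def sprayRicci (X : Fin n → Coord n → Coord n → ℝ) (x y : Coord n) : ℝ :=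
  2 * (∑ i, pdX i (X i) x y) - (∑ m, pdX m (vdiv X) x y * y m)
    + 2 * (∑ m, X m x y * pdY m (vdiv X) x y)
    - ∑ i, ∑ m, pdY m (X i) x y * pdY i (X m) x y

/-- Taking the trace turns the second-derivative terms into first derivatives of the vertical
divergence, so second derivatives of the individual coefficients are never needed. -/
lemma ricci_eq_sprayRicci (hW : IsOpen W) {F : Coord n → Coord n → ℝ}
    {X : Fin n → Coord n → Coord n → ℝ} (hX : ∀ i, SmoothOn W (X i))
    (hG : ∀ i x y, (x, y) ∈ W → geodesicCoeff F i x y = X i x y)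
    {x y : Coord n} (hp : (x, y) ∈ W) : ricci F x y = sprayRicci X x y := by
  have e1 : ∀ i k, pdX k (geodesicCoeff F i) x y = pdX k (X i) x y :=
    fun i k => pdX_congr hW (hG i) k hp
  have e2 : ∀ i k x y, (x, y) ∈ W → pdY k (geodesicCoeff F i) x y = pdY k (X i) x y :=
    fun i k x y hp => pdY_congr hW (hG i) k hp
  have e3 : ∀ i k m, pdX m (pdY k (geodesicCoeff F i)) x y = pdX m (pdY k (X i)) x y :=
    fun i k m => pdX_congr hW (e2 i k) m hp
  have e4 : ∀ i k m, pdY m (pdY k (geodesicCoeff F i)) x y = pdY m (pdY k (X i)) x y :=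
    fun i k m => pdY_congr hW (e2 i k) m hp
  have hd : ∀ i, DifferentiableAt ℝ (Function.uncurry (pdY i (X i))) (x, y) :=
    fun i => ((hX i).pdY hW i).differentiableAt hW hp
  have d1 : ∀ m, pdX m (vdiv X) x y = ∑ i, pdX m (pdY i (X i)) x y := fun m => pdX_sum m hd
  have d2 : ∀ m, pdY m (vdiv X) x y = ∑ i, pdY m (pdY i (X i)) x y := fun m => pdY_sum m hd
  simp only [ricci, riemannCurvature, sprayRicci, e1, e3, e4, e2 _ _ _ _ hp, hG _ _ _ hp, d1, d2,
    Finset.sum_add_distrib, Finset.sum_sub_distrib, ← Finset.mul_sum, Finset.sum_mul]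
  simp only [Finset.mul_sum]
  rw [Finset.sum_comm (f := fun i m => pdX m (pdY i (X i)) x y * y m),
    Finset.sum_comm (f := fun i m => 2 * (X m x y * pdY m (pdY i (X i)) x y))]

end Spray

/-! ### Smoothness of determinants and inverse matrices -/

section Smoothness

variable {n : ℕ} {U : Set (Coord n)}

lemma pd_congr (hU : IsOpen U) {f g : Coord n → ℝ} (h : ∀ x ∈ U, f x = g x) (k : Fin n)
    {x : Coord n} (hx : x ∈ U) : pd k f x = pd k g x := by
  have : f =ᶠ[nhds x] g := by
    filter_upwards [hU.mem_nhds hx] with z hz using h z hz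
  simp [pd, this.fderiv_eq]

lemma contDiffOn_pd (hU : IsOpen U) {f : Coord n → ℝ} (hf : ContDiffOn ℝ ∞ f U) (k : Fin n) :
    ContDiffOn ℝ ∞ (pd k f) U :=
  (hf.fderiv_of_isOpen hU (by simp)).clm_apply contDiffOn_const

lemma differentiableAt_of_contDiffOn (hU : IsOpen U) {f : Coord n → ℝ} (hf : ContDiffOn ℝ ∞ f U)
    {x : Coord n} (hx : x ∈ U) : DifferentiableAt ℝ f x :=
  (hf.contDiffAt (hU.mem_nhds hx)).differentiableAt (by simp)

lemma pd_sum_mul {f g : Fin n → Coord n → ℝ} {x : Coord n} (k : Fin n)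
    (hf : ∀ i, DifferentiableAt ℝ (f i) x) (hg : ∀ i, DifferentiableAt ℝ (g i) x) :
    pd k (fun z => ∑ i, f i z * g i z) x
      = ∑ i, (pd k (f i) x * g i x + f i x * pd k (g i) x) := by
  simp only [pd]
  rw [fderiv_fun_sum fun m _ => (hf m).fun_mul (hg m), _root_.sum_apply]
  refine Finset.sum_congr rfl fun m _ => ?_
  rw [fderiv_fun_mul (hf m) (hg m)]
  simp
  ring

lemma contDiffOn_det {E : Type*} [NormedAddCommGroup E] [NormedSpace ℝ E] {U : Set E}
    {A : E → Matrix (Fin n) (Fin n) ℝ}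
    (hA : ∀ i j, ContDiffOn ℝ ∞ (fun z => A z i j) U) :
    ContDiffOn ℝ ∞ (fun z => (A z).det) U := by
  simp only [Matrix.det_apply']
  exact ContDiffOn.sum fun σ _ => contDiffOn_const.mul (contDiffOn_prod fun i _ => hA _ _)

lemma contDiffOn_inv_apply {E : Type*} [NormedAddCommGroup E] [NormedSpace ℝ E] {U : Set E}
    {A : E → Matrix (Fin n) (Fin n) ℝ}
    (hA : ∀ i j, ContDiffOn ℝ ∞ (fun z => A z i j) U) (h0 : ∀ z ∈ U, (A z).det ≠ 0)
    (i j : Fin n) : ContDiffOn ℝ ∞ (fun z => (A z)⁻¹ i j) U := by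
  simp only [Matrix.inv_def, Ring.inverse_eq_inv', Matrix.smul_apply, smul_eq_mul,
    Matrix.adjugate_apply]
  refine ((contDiffOn_det hA).inv h0).mul (contDiffOn_det fun p q => ?_)
  -- By Cramer's rule the entry is a determinant in which row `j` has been replaced by a constant
  -- vector; the other rows are rows of `A`.
  by_cases hp : p = j
  · subst hp
    simp only [Matrix.updateRow_self]
    exact contDiffOn_const
  · simp only [Matrix.updateRow_ne hp]
    exact hA p q

end Smoothness

/-! ### Levi-Civita connection and covariant derivatives of the 1-form -/

section Tensors

variable {n : ℕ}

/-- The components of a smooth Riemannian metric on the coordinate domain `U`. -/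
structure IsMetricOn (U : Set (Coord n)) (a : Coord n → Matrix (Fin n) (Fin n) ℝ) : Prop where
  isOpen : IsOpen U
  smooth : ∀ i j, ContDiffOn ℝ ∞ (fun x => a x i j) U
  symm : ∀ x ∈ U, ∀ i j, a x i j = a x j i
  pos : ∀ x ∈ U, ∀ v : Fin n → ℝ, v ≠ 0 → 0 < v ⬝ᵥ (a x).mulVec v

/-- The components of a smooth `1`-form on the coordinate domain `U`. -/
def IsFormOn (U : Set (Coord n)) (b : Coord n → Fin n → ℝ) : Prop :=
  ∀ i, ContDiffOn ℝ ∞ (fun x => b x i) U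

variable {U : Set (Coord n)} {a : Coord n → Matrix (Fin n) (Fin n) ℝ} {b : Coord n → Fin n → ℝ}

namespace IsMetricOn

/-- A kernel vector would have zero length. -/
lemma det_ne_zero (h : IsMetricOn U a) {x : Coord n} (hx : x ∈ U) : (a x).det ≠ 0 := by
  intro h0
  obtain ⟨v, hv, hv0⟩ := Matrix.exists_mulVec_eq_zero_iff.2 h0
  have := h.pos x hx v hv
  simp [hv0] at this

lemma inv_mul (h : IsMetricOn U a) {x : Coord n} (hx : x ∈ U) : (a x)⁻¹ * a x = 1 :=
  Matrix.nonsing_inv_mul _ (h.det_ne_zero hx).isUnit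

lemma mul_inv (h : IsMetricOn U a) {x : Coord n} (hx : x ∈ U) : a x * (a x)⁻¹ = 1 :=
  Matrix.mul_nonsing_inv _ (h.det_ne_zero hx).isUnit

lemma transpose_eq (h : IsMetricOn U a) {x : Coord n} (hx : x ∈ U) : (a x).transpose = a x :=
  Matrix.ext fun i j => h.symm x hx j i

lemma transpose_inv (h : IsMetricOn U a) {x : Coord n} (hx : x ∈ U) :
    ((a x)⁻¹).transpose = (a x)⁻¹ := by
  rw [Matrix.transpose_nonsing_inv, h.transpose_eq hx]

lemma smooth_inv (h : IsMetricOn U a) (i j : Fin n) : ContDiffOn ℝ ∞ (fun x => (a x)⁻¹ i j) U :=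
  contDiffOn_inv_apply h.smooth (fun _ => h.det_ne_zero) i j

lemma smooth_pd (h : IsMetricOn U a) (i j k : Fin n) :
    ContDiffOn ℝ ∞ (pd k (fun z => a z i j)) U := contDiffOn_pd h.isOpen (h.smooth i j) k

lemma smooth_christoffel (h : IsMetricOn U a) (k i j : Fin n) :
    ContDiffOn ℝ ∞ (christoffel a k i j) U :=
  contDiffOn_const.mul (ContDiffOn.sum fun l _ => (h.smooth_inv k l).mul
    (((h.smooth_pd j l i).add (h.smooth_pd i l j)).sub (h.smooth_pd i j l)))

lemma christoffel_symm (h : IsMetricOn U a) {x : Coord n} (hx : x ∈ U) (k i j : Fin n) :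
    christoffel a k i j x = christoffel a k j i x := by
  unfold christoffel
  congr 1
  refine Finset.sum_congr rfl fun l _ => ?_
  rw [pd_congr h.isOpen (fun z hz => h.symm z hz i j) l hx]
  ring

/-- The Christoffel symbols with the upper index lowered. -/
lemma lower_christoffel (h : IsMetricOn U a) {x : Coord n} (hx : x ∈ U) (j i k : Fin n) :
    ∑ m, a x j m * christoffel a m i k x =
      (1 / 2) * (pd i (fun z => a z k j) x + pd k (fun z => a z i j) x
        - pd j (fun z => a z i k) x) := by
  set w : Fin n → ℝ := fun l =>
    pd i (fun z => a z k l) x + pd k (fun z => a z i l) x - pd l (fun z => a z i k) x with hw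
  have h1 : (a x).mulVec ((a x)⁻¹.mulVec w) = w := by
    rw [Matrix.mulVec_mulVec, h.mul_inv hx, Matrix.one_mulVec]
  have h2 := congrFun h1 j
  simp only [Matrix.mulVec, dotProduct] at h2
  simp only [christoffel]
  refine Eq.trans ?_ (congrArg (fun t => 1 / 2 * t) h2)
  simp only [hw]
  rw [Finset.mul_sum]
  exact Finset.sum_congr rfl fun m _ => by ring

/-- The metric is parallel. -/
lemma pd_metric (h : IsMetricOn U a) {x : Coord n} (hx : x ∈ U) (i j k : Fin n) :
    pd k (fun z => a z i j) x =
      ∑ m, christoffel a m i k x * a x m j + ∑ m, christoffel a m j k x * a x i m := by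
  have h1 := h.lower_christoffel hx j i k
  have h2 := h.lower_christoffel hx i j k
  have e1 : ∑ m, christoffel a m i k x * a x m j = ∑ m, a x j m * christoffel a m i k x :=
    Finset.sum_congr rfl fun m _ => by rw [h.symm x hx m j]; ring
  have e2 : ∑ m, christoffel a m j k x * a x i m = ∑ m, a x i m * christoffel a m j k x :=
    Finset.sum_congr rfl fun m _ => by ring
  rw [e1, e2, h1, h2, pd_congr h.isOpen (fun z hz => h.symm z hz k j) i hx,
    pd_congr h.isOpen (fun z hz => h.symm z hz k i) j hx,
    pd_congr h.isOpen (fun z hz => h.symm z hz j i) k hx]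
  ring

lemma smooth_cov (h : IsMetricOn U a) {w : Fin n → Coord n → ℝ}
    (hw : ∀ i, ContDiffOn ℝ ∞ (w i) U) (i k : Fin n) :
    ContDiffOn ℝ ∞ (covCovector a w i k) U :=
  (contDiffOn_pd h.isOpen (hw i) k).sub
    (ContDiffOn.sum fun m _ => (h.smooth_christoffel m i k).mul (hw m))

lemma smooth_db (h : IsMetricOn U a) (hb : IsFormOn U b) (i k : Fin n) :
    ContDiffOn ℝ ∞ (db a b i k) U := h.smooth_cov hb i k

lemma smooth_r (h : IsMetricOn U a) (hb : IsFormOn U b) (i k : Fin n) :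
    ContDiffOn ℝ ∞ (r a b i k) U :=
  contDiffOn_const.mul ((h.smooth_db hb i k).add (h.smooth_db hb k i))

lemma smooth_s (h : IsMetricOn U a) (hb : IsFormOn U b) (i k : Fin n) :
    ContDiffOn ℝ ∞ (s a b i k) U :=
  contDiffOn_const.mul ((h.smooth_db hb i k).sub (h.smooth_db hb k i))

lemma smooth_bUp (h : IsMetricOn U a) (hb : IsFormOn U b) (i : Fin n) :
    ContDiffOn ℝ ∞ (bUp a b i) U :=
  ContDiffOn.sum fun j _ => (h.smooth_inv i j).mul (hb j)

lemma smooth_bSq (h : IsMetricOn U a) (hb : IsFormOn U b) : ContDiffOn ℝ ∞ (bSq a b) U :=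
  ContDiffOn.sum fun i _ => (h.smooth_bUp hb i).mul (hb i)

lemma smooth_sMixed (h : IsMetricOn U a) (hb : IsFormOn U b) (i j : Fin n) :
    ContDiffOn ℝ ∞ (sMixed a b i j) U :=
  ContDiffOn.sum fun k _ => (h.smooth_inv i k).mul (h.smooth_s hb k j)

lemma smooth_rLow (h : IsMetricOn U a) (hb : IsFormOn U b) (j : Fin n) :
    ContDiffOn ℝ ∞ (rLow a b j) U :=
  ContDiffOn.sum fun i _ => (h.smooth_bUp hb i).mul (h.smooth_r hb i j)

lemma smooth_sLow (h : IsMetricOn U a) (hb : IsFormOn U b) (j : Fin n) :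
    ContDiffOn ℝ ∞ (sLow a b j) U :=
  ContDiffOn.sum fun i _ => (h.smooth_bUp hb i).mul (h.smooth_s hb i j)

/-- `bⁱ_{|k} = aⁱʲ b_{j|k}` -/
lemma pd_bUp (h : IsMetricOn U a) (hb : IsFormOn U b) {x : Coord n} (hx : x ∈ U) (i k : Fin n) :
    pd k (bUp a b i) x =
      ∑ j, (a x)⁻¹ i j * db a b j k x - ∑ m, christoffel a i m k x * bUp a b m x := by
  have hd : ∀ i, DifferentiableAt ℝ (bUp a b i) x :=
    fun i => differentiableAt_of_contDiffOn h.isOpen (h.smooth_bUp hb i) hx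
  have hda : ∀ i j, DifferentiableAt ℝ (fun x => a x i j) x :=
    fun i j => differentiableAt_of_contDiffOn h.isOpen (h.smooth i j) hx
  have hlow : ∀ z ∈ U, ∀ j, ∑ m, a z j m * bUp a b m z = b z j := by
    intro z hz j
    have h1 : (a z).mulVec ((a z)⁻¹.mulVec (b z)) = b z := by
      rw [Matrix.mulVec_mulVec, h.mul_inv hz, Matrix.one_mulVec]
    exact congrFun h1 j
  -- Differentiating `a_{jm} bᵐ = b_j` and using that the metric is parallel avoids differentiating
  -- the inverse matrix; applying `a⁻¹` afterwards raises the index.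
  have key : (a x).mulVec (fun m => pd k (bUp a b m) x) =
      (fun j => db a b j k x)
        - (a x).mulVec (fun m => ∑ l, christoffel a m l k x * bUp a b l x) := by
    funext j
    have h1 : pd k (fun z => b z j) x = ∑ m, (pd k (fun z => a z j m) x * bUp a b m x
        + a x j m * pd k (bUp a b m) x) := by
      rw [← pd_congr h.isOpen (fun z hz => hlow z hz j) k hx]
      exact pd_sum_mul k (hda j) hd
    simp only [h.pd_metric hx, Finset.sum_add_distrib, add_mul] at h1
    have e1 : ∑ m, (∑ l, christoffel a l j k x * a x l m) * bUp a b m x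
        = ∑ l, christoffel a l j k x * b x l := by
      simp only [Finset.sum_mul, ← hlow x hx, Finset.mul_sum]
      rw [Finset.sum_comm]
      exact Finset.sum_congr rfl fun _ _ => Finset.sum_congr rfl fun _ _ => by ring
    have e2 : ∑ m, (∑ l, christoffel a l m k x * a x j l) * bUp a b m x
        = ∑ l, a x j l * ∑ m, christoffel a l m k x * bUp a b m x := by
      simp only [Finset.sum_mul, Finset.mul_sum]
      rw [Finset.sum_comm]
      exact Finset.sum_congr rfl fun _ _ => Finset.sum_congr rfl fun _ _ => by ring
    rw [e1, e2] at h1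
    simp only [Matrix.mulVec, dotProduct, Pi.sub_apply, db, covCovector, h1]
    ring
  have key2 := congrArg ((a x)⁻¹.mulVec) key
  rw [Matrix.mulVec_sub, Matrix.mulVec_mulVec, Matrix.mulVec_mulVec, h.inv_mul hx,
    Matrix.one_mulVec, Matrix.one_mulVec] at key2
  exact congrFun key2 i

/-- `(b²)_{|k} = 2 bⁱ b_{i|k}` -/
lemma pd_bSq (h : IsMetricOn U a) (hb : IsFormOn U b) {x : Coord n} (hx : x ∈ U) (k : Fin n) :
    pd k (bSq a b) x = 2 * (rLow a b k x + sLow a b k x) := by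
  have hd : ∀ i, DifferentiableAt ℝ (bUp a b i) x :=
    fun i => differentiableAt_of_contDiffOn h.isOpen (h.smooth_bUp hb i) hx
  have hdb : ∀ i, DifferentiableAt ℝ (fun z => b z i) x :=
    fun i => differentiableAt_of_contDiffOn h.isOpen (hb i) hx
  have h1 : pd k (bSq a b) x = ∑ i, (pd k (bUp a b i) x * b x i
      + bUp a b i x * pd k (fun z => b z i) x) :=
    pd_sum_mul k hd hdb
  have h2 : ∀ i, pd k (fun z => b z i) x = db a b i k x + ∑ m, christoffel a m i k x * b x m :=
    fun i => by simp [db, covCovector]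
  have h3 : ∑ i, (∑ j, (a x)⁻¹ i j * db a b j k x) * b x i = ∑ i, bUp a b i x * db a b i k x := by
    simp only [bUp, Finset.sum_mul]
    rw [Finset.sum_comm]
    refine Finset.sum_congr rfl fun j _ => Finset.sum_congr rfl fun i _ => ?_
    rw [show (a x)⁻¹ i j = (a x)⁻¹ j i from congrFun (congrFun (h.transpose_inv hx) j) i]
    ring
  have h4 : ∑ i, (∑ m, christoffel a i m k x * bUp a b m x) * b x i
      = ∑ i, bUp a b i x * ∑ m, christoffel a m i k x * b x m := by
    simp only [Finset.sum_mul, Finset.mul_sum]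
    rw [Finset.sum_comm]
    exact Finset.sum_congr rfl fun _ _ => Finset.sum_congr rfl fun _ _ => by ring
  have h5 : rLow a b k x + sLow a b k x = ∑ i, bUp a b i x * db a b i k x := by
    simp only [rLow, sLow, ← Finset.sum_add_distrib]
    exact Finset.sum_congr rfl fun i _ => by rw [r, s]; ring
  rw [h1, h5]
  simp only [h.pd_bUp hb hx, h2, sub_mul, mul_add, Finset.sum_add_distrib,
    Finset.sum_sub_distrib, h3, h4]
  ring

end IsMetricOn

end Tensors

/-! ### Horizontal and vertical lifts -/

section Horizontal

variable {n : ℕ}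

/-- The nonlinear connection `Nᵐ_k = Γᵐ_{lk} yˡ` of the metric `a`. -/
def nonlinConn (a : Coord n → Matrix (Fin n) (Fin n) ℝ) (m k : Fin n) (x y : Coord n) : ℝ :=
  ∑ l, christoffel a m l k x * y l

/-- The horizontal lift of the `k`-th coordinate vector at `(x, y)`. -/
def hdir (a : Coord n → Matrix (Fin n) (Fin n) ℝ) (x y : Coord n) (k : Fin n) :
    Coord n × Coord n :=
  (unitVec k, WithLp.toLp 2 fun m => -nonlinConn a m k x y)

/-- The vertical lift of the `k`-th coordinate vector. -/
abbrev vdir (k : Fin n) : Coord n × Coord n := (0, unitVec k)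

lemma hdir_snd (a : Coord n → Matrix (Fin n) (Fin n) ℝ) (x y : Coord n) (k m : Fin n) :
    (hdir a x y k).2 m = -nonlinConn a m k x y := rfl

lemma unitVec_apply (k m : Fin n) : (unitVec k : Coord n) m = if m = k then 1 else 0 := by
  simp

variable (a : Coord n → Matrix (Fin n) (Fin n) ℝ)

/-- This is `∂/∂xᵏ = δ_k + Nᵐ_k ∂/∂yᵐ`, the splitting on which the whole comparison of curvatures
rests. -/
lemma unitVec_prod_zero_eq (x y : Coord n) (k : Fin n) :
    ((unitVec k, 0) : Coord n × Coord n) = hdir a x y k + ∑ m, nonlinConn a m k x y • vdir m := by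
  refine Prod.ext ?_ ?_
  · simp [hdir, Prod.fst_sum]
  · ext m
    simp [Prod.snd_sum, hdir_snd, Pi.single_apply]

variable {a}

lemma HasD.pdX_of_lifts {f : Coord n → Coord n → ℝ} {x y : Coord n} {k : Fin n} {dh : ℝ}
    {dv : Fin n → ℝ} (hh : HasD (fun q => f q.1 q.2) (x, y) (hdir a x y k) dh)
    (hv : ∀ m, HasD (fun q => f q.1 q.2) (x, y) (vdir m) (dv m)) :
    Finsler.pdX k f x y = dh + ∑ m, nonlinConn a m k x y * dv m := by
  refine (pdX_eq_fderiv k hh.1).trans ?_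
  rw [unitVec_prod_zero_eq a x y k, map_add, map_sum]
  refine congrArg₂ _ hh.2 (Finset.sum_congr rfl fun m _ => ?_)
  rw [map_smul, smul_eq_mul]
  exact congrArg _ (hv m).2

/-- A function of the position, in a horizontal direction. -/
lemma HasD.fst_hdir {f : Coord n → ℝ} {x y : Coord n} (k : Fin n) (hf : DifferentiableAt ℝ f x) :
    HasD (fun q => f q.1) (x, y) (hdir a x y k) (pd k f x) := HasD.of_fst hf

/-- A function of the position, in a vertical direction. -/
lemma HasD.fst_vdir {f : Coord n → ℝ} {x y : Coord n} (k : Fin n) (hf : DifferentiableAt ℝ f x) :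
    HasD (fun q => f q.1) (x, y) (vdir k) 0 :=
  (HasD.of_fst hf).congr_val (by simp)

lemma HasD.snd_hdir {x y : Coord n} (i k : Fin n) :
    HasD (fun q => q.2 i) (x, y) (hdir a x y k) (-nonlinConn a i k x y) := HasD.coord_snd i

lemma HasD.snd_vdir {x y : Coord n} (i k : Fin n) :
    HasD (fun q => q.2 i) (x, y) (vdir k) (if i = k then 1 else 0) :=
  (HasD.coord_snd i).congr_val (unitVec_apply k i)

variable {x y : Coord n}

/-- Horizontal derivative of a linear form `w_i yⁱ` whose coefficients have a free index. -/
lemma HasD.linear_hdir {w : Fin n → Coord n → ℝ} (hw : ∀ i, DifferentiableAt ℝ (w i) x)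
    (k : Fin n) : HasD (fun q => ∑ i, w i q.1 * q.2 i) (x, y) (hdir a x y k)
      (∑ i, covCovector a w i k x * y i) := by
  refine (HasD.sum fun i _ => (HasD.fst_hdir k (hw i)).mul (HasD.snd_hdir i k)).congr_val ?_
  simp only [covCovector, nonlinConn, sub_mul, mul_neg, Finset.sum_add_distrib,
    Finset.sum_sub_distrib, Finset.sum_neg_distrib, Finset.mul_sum, Finset.sum_mul]
  rw [sub_eq_add_neg, Finset.sum_comm]
  congr 2
  exact Finset.sum_congr rfl fun _ _ => Finset.sum_congr rfl fun _ _ => by ring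

lemma HasD.linear_vdir {w : Fin n → Coord n → ℝ} (hw : ∀ i, DifferentiableAt ℝ (w i) x)
    (k : Fin n) : HasD (fun q => ∑ i, w i q.1 * q.2 i) (x, y) (vdir k) (w k x) := by
  refine (HasD.sum fun i _ => (HasD.fst_vdir k (hw i)).mul (HasD.snd_vdir i k)).congr_val ?_
  simp

/-- Each factor `yⁱ` contributes `-Nⁱ_k`, and after renaming indices these are exactly the
Christoffel corrections of the covariant derivative. -/
lemma HasD.quadratic_hdir {t : Fin n → Fin n → Coord n → ℝ}
    (ht : ∀ i j, DifferentiableAt ℝ (t i j) x) (k : Fin n) :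
    HasD (fun q => ∑ i, ∑ j, t i j q.1 * q.2 i * q.2 j) (x, y) (hdir a x y k)
      (∑ i, ∑ j, covTwo a t i j k x * y i * y j) := by
  refine (HasD.sum fun i _ => HasD.sum fun j _ => ((HasD.fst_hdir k (ht i j)).mul
    (HasD.snd_hdir i k)).mul (HasD.snd_hdir j k)).congr_val ?_
  simp only [covTwo, nonlinConn, sub_mul, mul_neg, add_mul, neg_mul, Finset.sum_add_distrib,
    Finset.sum_sub_distrib, Finset.sum_neg_distrib, Finset.mul_sum, Finset.sum_mul]
  have e1 : ∑ i, ∑ j, ∑ m, t i j x * (christoffel a i m k x * y m) * y j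
      = ∑ i, ∑ j, ∑ m, christoffel a m i k x * t m j x * y i * y j := by
    conv_lhs => enter [2, i]; rw [Finset.sum_comm]
    rw [Finset.sum_comm]
    refine Finset.sum_congr rfl fun i _ => ?_
    rw [Finset.sum_comm]
    exact Finset.sum_congr rfl fun _ _ => Finset.sum_congr rfl fun _ _ => by ring
  have e2 : ∑ i, ∑ j, ∑ m, t i j x * y i * (christoffel a j m k x * y m)
      = ∑ i, ∑ j, ∑ m, christoffel a m j k x * t i m x * y i * y j := by
    refine Finset.sum_congr rfl fun i _ => ?_
    rw [Finset.sum_comm]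
    exact Finset.sum_congr rfl fun _ _ => Finset.sum_congr rfl fun _ _ => by ring
  rw [e1, e2]
  ring

lemma HasD.quadratic_vdir {t : Fin n → Fin n → Coord n → ℝ}
    (ht : ∀ i j, DifferentiableAt ℝ (t i j) x) (hs : ∀ i j, t i j x = t j i x) (k : Fin n) :
    HasD (fun q => ∑ i, ∑ j, t i j q.1 * q.2 i * q.2 j) (x, y) (vdir k)
      (2 * ∑ j, t j k x * y j) := by
  refine (HasD.sum fun i _ => HasD.sum fun j _ => ((HasD.fst_vdir k (ht i j)).mul
    (HasD.snd_vdir i k)).mul (HasD.snd_vdir j k)).congr_val ?_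
  simp only [zero_mul, zero_add, mul_ite, mul_one, mul_zero, Finset.sum_add_distrib, ite_mul,
    Finset.sum_ite_eq', Finset.mem_univ, if_true]
  rw [Finset.sum_comm]
  simp only [Finset.sum_ite_eq', Finset.mem_univ, if_true, hs k]
  ring

/-- The upper index is not contracted, so `δ_k` does not see its Christoffel term. The subtracted
sum records this defect, which `sprayRicci_add` later absorbs. -/
lemma HasD.mixed_hdir {t : Fin n → Fin n → Coord n → ℝ}
    (ht : ∀ i j, DifferentiableAt ℝ (t i j) x) (i k : Fin n) :
    HasD (fun q => ∑ j, t i j q.1 * q.2 j) (x, y) (hdir a x y k)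
      (∑ j, covMixed a t i j k x * y j - ∑ m, christoffel a i m k x * ∑ j, t m j x * y j) := by
  refine (HasD.linear_hdir (ht i) k).congr_val ?_
  simp only [covMixed, covCovector, sub_mul, add_mul, Finset.sum_add_distrib,
    Finset.sum_sub_distrib, Finset.mul_sum, Finset.sum_mul]
  have e : ∑ j, ∑ m, christoffel a i m k x * t m j x * y j
      = ∑ m, ∑ j, christoffel a i m k x * (t m j x * y j) := by
    rw [Finset.sum_comm]
    exact Finset.sum_congr rfl fun _ _ => Finset.sum_congr rfl fun _ _ => by ring
  rw [e]
  ring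

end Horizontal

/-! ### Derivatives of the basic fields along the lifts -/

section Fields

variable {n : ℕ} {U : Set (Coord n)} {a : Coord n → Matrix (Fin n) (Fin n) ℝ}
  {b : Coord n → Fin n → ℝ} {x y : Coord n}

/-- `y_i = a_{ij} yʲ` -/
def yLow (a : Coord n → Matrix (Fin n) (Fin n) ℝ) (i : Fin n) (x y : Coord n) : ℝ :=
  ∑ j, a x i j * y j

/-- `s_{i0} = s_{ij} yʲ` -/
def si0 (a : Coord n → Matrix (Fin n) (Fin n) ℝ) (b : Coord n → Fin n → ℝ) (i : Fin n)
    (x y : Coord n) : ℝ := ∑ j, s a b i j x * y j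

namespace IsMetricOn

lemma diff (h : IsMetricOn U a) {f : Coord n → ℝ} (hf : ContDiffOn ℝ ∞ f U) (hx : x ∈ U) :
    DifferentiableAt ℝ f x := differentiableAt_of_contDiffOn h.isOpen hf hx

lemma covTwo_metric (h : IsMetricOn U a) (hx : x ∈ U) (i j k : Fin n) :
    covTwo a (fun i j z => a z i j) i j k x = 0 := by
  rw [covTwo, h.pd_metric hx]
  ring

variable (h : IsMetricOn U a) (hb : IsFormOn U b) (hx : x ∈ U)
include h hx

/-- The metric is parallel. This is why horizontal differentiation is preferred to `∂/∂xᵏ`. -/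
lemma alphaSq_hdir (k : Fin n) :
    HasD (fun q => alphaSq a q.1 q.2) (x, y) (hdir a x y k) 0 := by
  refine (HasD.quadratic_hdir (t := fun i j z => a z i j)
    (fun i j => h.diff (h.smooth i j) hx) k).congr_val ?_
  simp [h.covTwo_metric hx]

lemma alphaSq_vdir (k : Fin n) :
    HasD (fun q => alphaSq a q.1 q.2) (x, y) (vdir k) (2 * yLow a k x y) := by
  refine (HasD.quadratic_vdir (t := fun i j z => a z i j)
    (fun i j => h.diff (h.smooth i j) hx) (h.symm x hx) k).congr_val ?_
  simp only [yLow, h.symm x hx k]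

lemma yLow_hdir (i k : Fin n) : HasD (fun q => yLow a i q.1 q.2) (x, y) (hdir a x y k)
    (∑ m, christoffel a m i k x * yLow a m x y) := by
  refine (HasD.linear_hdir (w := fun j z => a z i j)
    (fun j => h.diff (h.smooth i j) hx) k).congr_val ?_
  simp only [covCovector, h.pd_metric hx, add_sub_cancel_right, yLow, Finset.sum_mul,
    Finset.mul_sum]
  rw [Finset.sum_comm]
  exact Finset.sum_congr rfl fun _ _ => Finset.sum_congr rfl fun _ _ => by ring

lemma yLow_vdir (i k : Fin n) :
    HasD (fun q => yLow a i q.1 q.2) (x, y) (vdir k) (a x i k) :=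
  HasD.linear_vdir (w := fun j z => a z i j) (fun j => h.diff (h.smooth i j) hx) k

include hb

lemma form_hdir (i k : Fin n) : HasD (fun q => b q.1 i) (x, y) (hdir a x y k)
    (db a b i k x + ∑ m, christoffel a m i k x * b x m) :=
  (HasD.fst_hdir k (h.diff (hb i) hx)).congr_val (by simp [db, covCovector])

lemma form_vdir (i k : Fin n) : HasD (fun q => b q.1 i) (x, y) (vdir k) 0 :=
  HasD.fst_vdir k (h.diff (hb i) hx)

/-- The contracted index of `b_{i|k}` is the first one, so `b_{i|k} yⁱ = r_{0k} + s_{0k}`, and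
`s_{0k} = -s_{k0}` gives the minus sign. -/
lemma beta_hdir (k : Fin n) :
    HasD (fun q => beta b q.1 q.2) (x, y) (hdir a x y k) (r0k a b k x y - si0 a b k x y) := by
  refine (HasD.linear_hdir (w := fun i z => b z i) (fun i => h.diff (hb i) hx) k).congr_val ?_
  simp only [r0k, si0, ← Finset.sum_sub_distrib, ← sub_mul]
  refine Finset.sum_congr rfl fun i _ => ?_
  congr 1
  rw [r, s, db, db]
  ring

lemma beta_vdir (k : Fin n) : HasD (fun q => beta b q.1 q.2) (x, y) (vdir k) (b x k) :=
  HasD.linear_vdir (w := fun i z => b z i) (fun i => h.diff (hb i) hx) k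

lemma bSq_hdir (k : Fin n) : HasD (fun q => bSq a b q.1) (x, y) (hdir a x y k)
    (2 * (rLow a b k x + sLow a b k x)) :=
  (HasD.fst_hdir k (h.diff (h.smooth_bSq hb) hx)).congr_val (h.pd_bSq hb hx k)

lemma bSq_vdir (k : Fin n) : HasD (fun q => bSq a b q.1) (x, y) (vdir k) 0 :=
  HasD.fst_vdir k (h.diff (h.smooth_bSq hb) hx)

lemma bUp_hdir (i k : Fin n) : HasD (fun q => bUp a b i q.1) (x, y) (hdir a x y k)
    (∑ j, (a x)⁻¹ i j * db a b j k x - ∑ m, christoffel a i m k x * bUp a b m x) :=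
  (HasD.fst_hdir k (h.diff (h.smooth_bUp hb i) hx)).congr_val (h.pd_bUp hb hx i k)

lemma bUp_vdir (i k : Fin n) : HasD (fun q => bUp a b i q.1) (x, y) (vdir k) 0 :=
  HasD.fst_vdir k (h.diff (h.smooth_bUp hb i) hx)

lemma s0_hdir (k : Fin n) :
    HasD (fun q => s0 a b q.1 q.2) (x, y) (hdir a x y k) (s0Cov a b k x y) :=
  HasD.linear_hdir (fun i => h.diff (h.smooth_sLow hb i) hx) k

lemma s0_vdir (k : Fin n) : HasD (fun q => s0 a b q.1 q.2) (x, y) (vdir k) (sLow a b k x) :=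
  HasD.linear_vdir (fun i => h.diff (h.smooth_sLow hb i) hx) k

lemma r0_hdir (k : Fin n) :
    HasD (fun q => r0 a b q.1 q.2) (x, y) (hdir a x y k) (r0Cov a b k x y) :=
  HasD.linear_hdir (fun i => h.diff (h.smooth_rLow hb i) hx) k

lemma r0_vdir (k : Fin n) : HasD (fun q => r0 a b q.1 q.2) (x, y) (vdir k) (rLow a b k x) :=
  HasD.linear_vdir (fun i => h.diff (h.smooth_rLow hb i) hx) k

lemma r00_hdir (k : Fin n) :
    HasD (fun q => r00 a b q.1 q.2) (x, y) (hdir a x y k) (r00Cov a b k x y) :=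
  HasD.quadratic_hdir (fun i j => h.diff (h.smooth_r hb i j) hx) k

lemma r00_vdir (k : Fin n) :
    HasD (fun q => r00 a b q.1 q.2) (x, y) (vdir k) (2 * r0k a b k x y) :=
  HasD.quadratic_vdir (fun i j => h.diff (h.smooth_r hb i j) hx)
    (fun i j => by rw [r, r, add_comm]) k

lemma sMixed0_hdir (i k : Fin n) : HasD (fun q => sMixed0 a b i q.1 q.2) (x, y) (hdir a x y k)
    (∑ j, covMixed a (sMixed a b) i j k x * y j
      - ∑ m, christoffel a i m k x * sMixed0 a b m x y) :=
  HasD.mixed_hdir (fun i j => h.diff (h.smooth_sMixed hb i j) hx) i k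

lemma sMixed0_vdir (i k : Fin n) :
    HasD (fun q => sMixed0 a b i q.1 q.2) (x, y) (vdir k) (sMixed a b i k x) :=
  HasD.linear_vdir (fun j => h.diff (h.smooth_sMixed hb i j) hx) k

end IsMetricOn

end Fields

/-! ### Perturbing the spray of a Riemannian metric -/

section RiemannSpray

variable {n : ℕ} {U : Set (Coord n)} {a : Coord n → Matrix (Fin n) (Fin n) ℝ}
  {W : Set (Coord n × Coord n)} {x y : Coord n}

/-- The geodesic spray `½ Γⁱ_{jk} yʲ yᵏ` of the metric `a`. -/
def riemannSpray (a : Coord n → Matrix (Fin n) (Fin n) ℝ) (i : Fin n) (x y : Coord n) : ℝ :=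
  (1 / 2) * ∑ j, ∑ k, christoffel a i j k x * y j * y k

lemma smoothOn_fst (hWU : ∀ p ∈ W, p.1 ∈ U) {f : Coord n → ℝ} (hf : ContDiffOn ℝ ∞ f U) :
    ContDiffOn ℝ ∞ (fun p : Coord n × Coord n => f p.1) W :=
  hf.comp contDiff_fst.contDiffOn hWU

lemma smoothOn_snd (i : Fin n) :
    ContDiffOn ℝ ∞ (fun p : Coord n × Coord n => p.2 i) W :=
  ((EuclideanSpace.proj i : Coord n →L[ℝ] ℝ).contDiff.comp contDiff_snd).contDiffOn

lemma smoothOn_linear (hWU : ∀ p ∈ W, p.1 ∈ U) {w : Fin n → Coord n → ℝ}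
    (hw : ∀ i, ContDiffOn ℝ ∞ (w i) U) : SmoothOn W fun x y => ∑ i, w i x * y i :=
  ContDiffOn.sum fun i _ => (smoothOn_fst hWU (hw i)).mul (smoothOn_snd i)

lemma smoothOn_quadratic (hWU : ∀ p ∈ W, p.1 ∈ U) {t : Fin n → Fin n → Coord n → ℝ}
    (ht : ∀ i j, ContDiffOn ℝ ∞ (t i j) U) :
    SmoothOn W fun x y => ∑ i, ∑ j, t i j x * y i * y j :=
  ContDiffOn.sum fun i _ => ContDiffOn.sum fun j _ =>
    ((smoothOn_fst hWU (ht i j)).mul (smoothOn_snd i)).mul (smoothOn_snd j)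

lemma sum_nonlinConn_mul (a : Coord n → Matrix (Fin n) (Fin n) ℝ) (i : Fin n) (x y : Coord n) :
    ∑ m, nonlinConn a i m x y * y m = 2 * riemannSpray a i x y := by
  simp only [nonlinConn, riemannSpray, Finset.sum_mul]
  rw [Finset.sum_comm]
  ring

lemma smoothOn_riemannSpray (h : IsMetricOn U a) (hWU : ∀ p ∈ W, p.1 ∈ U) (i : Fin n) :
    SmoothOn W (riemannSpray a i) :=
  contDiffOn_const.mul (smoothOn_quadratic hWU (h.smooth_christoffel i))

lemma pdY_riemannSpray (h : IsMetricOn U a) (hx : x ∈ U) (i k : Fin n) :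
    pdY k (riemannSpray a i) x y = nonlinConn a i k x y := by
  refine HasD.pdY (((HasD.quadratic_vdir
    (fun p q => h.diff (h.smooth_christoffel i p q) hx)
    (fun p q => h.christoffel_symm hx i p q) k).const_mul (1 / 2)).congr_val ?_)
  rw [nonlinConn]
  ring

lemma vdiv_riemannSpray (h : IsMetricOn U a) (hx : x ∈ U) :
    vdiv (riemannSpray a) x y = ∑ i, nonlinConn a i i x y :=
  Finset.sum_congr rfl fun i _ => pdY_riemannSpray h hx i i

lemma pdY_vdiv_riemannSpray (h : IsMetricOn U a) (hW : IsOpen W) (hWU : ∀ p ∈ W, p.1 ∈ U)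
    (hp : (x, y) ∈ W) (m : Fin n) :
    pdY m (vdiv (riemannSpray a)) x y = ∑ i, christoffel a i m i x := by
  rw [pdY_congr hW (fun x y hq => vdiv_riemannSpray h (hWU _ hq)) m hp]
  exact HasD.pdY (HasD.sum fun i _ => HasD.linear_vdir
    (fun l => h.diff (h.smooth_christoffel i l i) (hWU _ hp)) m)

lemma smoothOn_vdiv (hW : IsOpen W) {X : Fin n → Coord n → Coord n → ℝ}
    (hX : ∀ i, SmoothOn W (X i)) : SmoothOn W (vdiv X) := by
  have : ContDiffOn ℝ ∞ (fun p => ∑ i, Function.uncurry (pdY i (X i)) p) W :=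
    ContDiffOn.sum fun i _ => (hX i).pdY hW i
  exact this

/-- The change of the Ricci curvature when a vector field `H` is added to the geodesic spray
of a Riemannian metric, in terms of horizontal and vertical derivatives. -/
lemma sprayRicci_add (h : IsMetricOn U a) (hW : IsOpen W) (hWU : ∀ p ∈ W, p.1 ∈ U)
    {H : Fin n → Coord n → Coord n → ℝ} (hH : ∀ i, SmoothOn W (H i))
    {D : Coord n → Coord n → ℝ} (hD : ∀ x y, (x, y) ∈ W → vdiv H x y = D x y)
    (hp : (x, y) ∈ W) {c : Fin n → ℝ} {M : Fin n → Fin n → ℝ} {dh dv : Fin n → ℝ}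
    (hHh : ∀ i, HasD (fun q => H i q.1 q.2) (x, y) (hdir a x y i)
      (c i - ∑ m, christoffel a i m i x * H m x y))
    (hHv : ∀ i m, HasD (fun q => H i q.1 q.2) (x, y) (vdir m) (M i m))
    (hDh : ∀ k, HasD (fun q => D q.1 q.2) (x, y) (hdir a x y k) (dh k))
    (hDv : ∀ m, HasD (fun q => D q.1 q.2) (x, y) (vdir m) (dv m)) :
    sprayRicci (fun i x y => riemannSpray a i x y + H i x y) x y =
      sprayRicci (riemannSpray a) x y + (2 * (∑ i, c i) - (∑ k, dh k * y k)
        + 2 * (∑ m, H m x y * dv m) - ∑ i, ∑ m, M i m * M m i) := by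
  have hG := smoothOn_riemannSpray h hWU
  have hx := hWU _ hp
  have dG : ∀ {x y}, (x, y) ∈ W → ∀ i, DifferentiableAt ℝ
      (Function.uncurry (riemannSpray a i)) (x, y) := fun hq i => (hG i).differentiableAt hW hq
  have dH : ∀ {x y}, (x, y) ∈ W → ∀ i, DifferentiableAt ℝ
      (Function.uncurry (H i)) (x, y) := fun hq i => (hH i).differentiableAt hW hq
  have e1 : ∀ i, pdX i (fun x y => riemannSpray a i x y + H i x y) x y
      = pdX i (riemannSpray a i) x y + (c i - ∑ m, christoffel a i m i x * H m x y
        + ∑ m, nonlinConn a m i x y * M i m) := fun i => by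
    rw [pdX_add i (dG hp i) (dH hp i), HasD.pdX_of_lifts (hHh i) (hHv i)]
  have e2 : ∀ i m, pdY m (fun x y => riemannSpray a i x y + H i x y) x y
      = nonlinConn a i m x y + M i m := fun i m => by
    rw [pdY_add m (dG hp i) (dH hp i), HasD.pdY (hHv i m), pdY_riemannSpray h hx]
  have e3 : ∀ x y, (x, y) ∈ W → vdiv (fun i x y => riemannSpray a i x y + H i x y) x y
      = vdiv (riemannSpray a) x y + D x y := fun x y hq => by
    rw [← hD x y hq]
    simp only [vdiv, ← Finset.sum_add_distrib]
    exact Finset.sum_congr rfl fun i _ => pdY_add i (dG hq i) (dH hq i)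
  have dvG : DifferentiableAt ℝ (Function.uncurry (vdiv (riemannSpray a))) (x, y) :=
    (smoothOn_vdiv hW hG).differentiableAt hW hp
  have e4 : ∀ m, pdX m (vdiv fun i x y => riemannSpray a i x y + H i x y) x y
      = pdX m (vdiv (riemannSpray a)) x y + (dh m + ∑ l, nonlinConn a l m x y * dv l) :=
    fun m => by
      rw [pdX_congr hW e3 m hp, pdX_add m dvG (hDh m).1, HasD.pdX_of_lifts (hDh m) hDv]
  have e5 : ∀ m, pdY m (vdiv fun i x y => riemannSpray a i x y + H i x y) x y
      = ∑ i, christoffel a i m i x + dv m := fun m => by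
    rw [pdY_congr hW e3 m hp, pdY_add m dvG (hDv m).1, HasD.pdY (hDv m),
      pdY_vdiv_riemannSpray h hW hWU hp]
  -- Three cancellations remove what is not tensorial. Since `Nˡ_m yᵐ = 2Gˡ`, the vertical part of
  -- `D_{xᵐ} yᵐ` cancels `2Gˡ ∂D/∂yˡ` (`s1`, `s5`). The Christoffel defect of `H` cancels `2Hᵐ
  -- Γⁱ_{mi}` (`s2`). The vertical part of `2 ∂Hⁱ/∂xⁱ` cancels the two mixed terms of the quadratic
  -- expression (`s3`, `s4`).
  have s1 : ∑ m, (∑ l, nonlinConn a l m x y * dv l) * y m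
      = ∑ l, 2 * riemannSpray a l x y * dv l := by
    simp only [← sum_nonlinConn_mul, Finset.sum_mul]
    rw [Finset.sum_comm]
    exact Finset.sum_congr rfl fun _ _ => Finset.sum_congr rfl fun _ _ => by ring
  have s2 : ∑ i, ∑ m, christoffel a i m i x * H m x y
      = ∑ m, H m x y * ∑ i, christoffel a i m i x := by
    rw [Finset.sum_comm]
    simp only [Finset.mul_sum]
    exact Finset.sum_congr rfl fun _ _ => Finset.sum_congr rfl fun _ _ => by ring
  have s3 : ∑ i, ∑ m, nonlinConn a i m x y * M m i = ∑ i, ∑ m, nonlinConn a m i x y * M i m :=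
    Finset.sum_comm
  have s4 : ∑ i, ∑ m, M i m * nonlinConn a m i x y = ∑ i, ∑ m, nonlinConn a m i x y * M i m :=
    Finset.sum_congr rfl fun _ _ => Finset.sum_congr rfl fun _ _ => by ring
  have s5 : ∑ l, 2 * riemannSpray a l x y * dv l = 2 * ∑ l, riemannSpray a l x y * dv l := by
    rw [Finset.mul_sum]
    exact Finset.sum_congr rfl fun _ _ => by ring
  simp only [sprayRicci, e1, e2, e4, e5, pdY_riemannSpray h hx,
    pdY_vdiv_riemannSpray h hW hWU hp, add_mul, mul_add, Finset.sum_add_distrib,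
    Finset.sum_sub_distrib, s1, s2, s3, s4, s5]
  ring

end RiemannSpray

/-! ### Table of contractions -/

section Contractions

variable {n : ℕ} {U : Set (Coord n)} {a : Coord n → Matrix (Fin n) (Fin n) ℝ}
  {b : Coord n → Fin n → ℝ} {x y : Coord n}

/-- The matrix `(s_{ij})`. -/
def sMat (a : Coord n → Matrix (Fin n) (Fin n) ℝ) (b : Coord n → Fin n → ℝ) (x : Coord n) :
    Matrix (Fin n) (Fin n) ℝ := Matrix.of fun i j => s a b i j x

/-- The matrix `(r_{ij})`. -/
def rMat (a : Coord n → Matrix (Fin n) (Fin n) ℝ) (b : Coord n → Fin n → ℝ) (x : Coord n) :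
    Matrix (Fin n) (Fin n) ℝ := Matrix.of fun i j => r a b i j x

open Matrix

lemma bUp_eq : (bUp a b · x) = (a x)⁻¹ *ᵥ b x := rfl

lemma yLow_eq : (yLow a · x y) = a x *ᵥ y.ofLp := rfl

lemma si0_eq : (si0 a b · x y) = sMat a b x *ᵥ y.ofLp := rfl

lemma sUp_eq : (sUp a b · x) = (a x)⁻¹ *ᵥ (sLow a b · x) := rfl

lemma transpose_sMat : (sMat a b x)ᵀ = -sMat a b x := by
  ext i j
  simp only [sMat, transpose_apply, of_apply, Matrix.neg_apply, s]
  ring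

lemma transpose_rMat : (rMat a b x)ᵀ = rMat a b x := by
  ext i j
  simp only [rMat, transpose_apply, of_apply, r]
  ring

lemma dotProduct_sMat_mulVec (u v : Fin n → ℝ) :
    u ⬝ᵥ sMat a b x *ᵥ v = -(v ⬝ᵥ sMat a b x *ᵥ u) := by
  rw [dotProduct_mulVec, ← mulVec_transpose, transpose_sMat, neg_mulVec, neg_dotProduct,
    dotProduct_comm]

lemma dotProduct_rMat_mulVec (u v : Fin n → ℝ) :
    u ⬝ᵥ rMat a b x *ᵥ v = v ⬝ᵥ rMat a b x *ᵥ u := by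
  rw [dotProduct_mulVec, ← mulVec_transpose, transpose_rMat, dotProduct_comm]

lemma dotProduct_sMat_self (u : Fin n → ℝ) : u ⬝ᵥ sMat a b x *ᵥ u = 0 := by
  have := dotProduct_sMat_mulVec (a := a) (b := b) (x := x) u u
  linarith

/-- The sign appears because `s_j` contracts the first index of `s_{ij}`, whereas a matrix acts
through the second. -/
lemma sLow_eq : (sLow a b · x) = -(sMat a b x *ᵥ (bUp a b · x)) := by
  rw [← neg_mulVec, ← transpose_sMat, mulVec_transpose]
  rfl

lemma rLow_eq : (rLow a b · x) = rMat a b x *ᵥ (bUp a b · x) := by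
  rw [← transpose_rMat, mulVec_transpose]
  rfl

lemma r0k_eq : (r0k a b · x y) = rMat a b x *ᵥ y.ofLp := by
  rw [← transpose_rMat]
  rfl

lemma sMixed_eq : (Matrix.of fun i j => sMixed a b i j x) = (a x)⁻¹ * sMat a b x := rfl

lemma sMixed0_eq : (sMixed0 a b · x y) = (a x)⁻¹ *ᵥ (si0 a b · x y) := by
  rw [si0_eq, mulVec_mulVec]
  rfl

lemma dotProduct_y_yLow : (yLow a · x y) ⬝ᵥ y.ofLp = alphaSq a x y := by
  simp only [dotProduct, yLow, alphaSq, Finset.sum_mul]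
  exact Finset.sum_congr rfl fun _ _ => Finset.sum_congr rfl fun _ _ => by ring

lemma dotProduct_b_y : b x ⬝ᵥ y.ofLp = beta b x y := rfl

lemma dotProduct_b_bUp : b x ⬝ᵥ (bUp a b · x) = bSq a b x := dotProduct_comm _ _

lemma dotProduct_sLow_y : (sLow a b · x) ⬝ᵥ y.ofLp = s0 a b x y := rfl

lemma dotProduct_rLow_y : (rLow a b · x) ⬝ᵥ y.ofLp = r0 a b x y := rfl

lemma dotProduct_sLow_bUp : (sLow a b · x) ⬝ᵥ (bUp a b · x) = 0 := by
  rw [sLow_eq, neg_dotProduct, dotProduct_comm, dotProduct_sMat_self, neg_zero]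

lemma dotProduct_rLow_bUp : (rLow a b · x) ⬝ᵥ (bUp a b · x) = rScalar a b x :=
  dotProduct_comm _ _

lemma dotProduct_si0_y : (si0 a b · x y) ⬝ᵥ y.ofLp = 0 := by
  rw [si0_eq, dotProduct_comm, dotProduct_sMat_self]

lemma dotProduct_si0_bUp : (si0 a b · x y) ⬝ᵥ (bUp a b · x) = s0 a b x y := by
  rw [← dotProduct_sLow_y, sLow_eq, si0_eq, dotProduct_comm, dotProduct_sMat_mulVec,
    neg_dotProduct, dotProduct_comm (y.ofLp)]

lemma dotProduct_r0k_y : (r0k a b · x y) ⬝ᵥ y.ofLp = r00 a b x y := by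
  rw [r0k_eq]
  simp only [dotProduct, mulVec, rMat, r00, Finset.sum_mul, of_apply]
  exact Finset.sum_congr rfl fun _ _ => Finset.sum_congr rfl fun _ _ => by ring

lemma dotProduct_r0k_bUp : (r0k a b · x y) ⬝ᵥ (bUp a b · x) = r0 a b x y := by
  rw [← dotProduct_rLow_y, rLow_eq, r0k_eq, dotProduct_comm, dotProduct_rMat_mulVec,
    dotProduct_comm]

lemma sMixed_mulVec_y :
    (Matrix.of fun i j => sMixed a b i j x) *ᵥ y.ofLp = (sMixed0 a b · x y) := rfl

lemma sMixed_mulVec_bUp :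
    (Matrix.of fun i j => sMixed a b i j x) *ᵥ (bUp a b · x) = -(sUp a b · x) := by
  rw [sMixed_eq, ← mulVec_mulVec, sUp_eq, sLow_eq, mulVec_neg, neg_neg]

namespace IsMetricOn

variable (h : IsMetricOn U a) (hx : x ∈ U)
include h hx

lemma dotProduct_inv_mulVec (u v : Fin n → ℝ) :
    u ⬝ᵥ (a x)⁻¹ *ᵥ v = ((a x)⁻¹ *ᵥ u) ⬝ᵥ v := by
  rw [dotProduct_mulVec, ← mulVec_transpose, h.transpose_inv hx]

lemma yLow_dotProduct_inv_mulVec (v : Fin n → ℝ) :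
    (yLow a · x y) ⬝ᵥ (a x)⁻¹ *ᵥ v = y.ofLp ⬝ᵥ v := by
  rw [h.dotProduct_inv_mulVec hx, yLow_eq, mulVec_mulVec, h.inv_mul hx, one_mulVec]

lemma dotProduct_yLow_sMixed0 : (yLow a · x y) ⬝ᵥ (sMixed0 a b · x y) = 0 := by
  rw [sMixed0_eq, h.yLow_dotProduct_inv_mulVec hx, dotProduct_comm, dotProduct_si0_y]

lemma dotProduct_yLow_bUp : (yLow a · x y) ⬝ᵥ (bUp a b · x) = beta b x y := by
  rw [bUp_eq, h.yLow_dotProduct_inv_mulVec hx, dotProduct_comm, dotProduct_b_y]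

lemma dotProduct_b_sMixed0 : b x ⬝ᵥ (sMixed0 a b · x y) = s0 a b x y := by
  rw [sMixed0_eq, h.dotProduct_inv_mulVec hx, ← bUp_eq, dotProduct_comm, dotProduct_si0_bUp]

lemma dotProduct_yLow_sUp : (yLow a · x y) ⬝ᵥ (sUp a b · x) = s0 a b x y := by
  rw [sUp_eq, h.yLow_dotProduct_inv_mulVec hx, dotProduct_comm, dotProduct_sLow_y]

lemma dotProduct_b_sUp : b x ⬝ᵥ (sUp a b · x) = 0 := by
  rw [sUp_eq, h.dotProduct_inv_mulVec hx, ← bUp_eq, dotProduct_comm, dotProduct_sLow_bUp]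

lemma dotProduct_yLow_sMixed_mulVec (v : Fin n → ℝ) :
    (yLow a · x y) ⬝ᵥ (Matrix.of fun i j => sMixed a b i j x) *ᵥ v
      = -((si0 a b · x y) ⬝ᵥ v) := by
  rw [sMixed_eq, ← mulVec_mulVec, h.yLow_dotProduct_inv_mulVec hx, dotProduct_sMat_mulVec,
    si0_eq, dotProduct_comm]

lemma dotProduct_b_sMixed_mulVec (v : Fin n → ℝ) :
    b x ⬝ᵥ (Matrix.of fun i j => sMixed a b i j x) *ᵥ v = (sLow a b · x) ⬝ᵥ v := by
  rw [sMixed_eq, ← mulVec_mulVec, h.dotProduct_inv_mulVec hx, ← bUp_eq, dotProduct_sMat_mulVec,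
    sLow_eq, neg_dotProduct, dotProduct_comm]

/-- The product of a symmetric and an antisymmetric matrix is traceless: transposition changes its
sign up to cyclic order. -/
lemma trace_sMixed : (Matrix.of fun i j => sMixed a b i j x).trace = 0 := by
  have : ((a x)⁻¹ * sMat a b x).trace = -((a x)⁻¹ * sMat a b x).trace := by
    conv_lhs => rw [← trace_transpose, transpose_mul, transpose_sMat, h.transpose_inv hx,
      neg_mul, trace_neg, trace_mul_comm]
  rw [sMixed_eq]
  linarith

lemma sum_inv_mul_db : ∑ i, ∑ j, (a x)⁻¹ i j * db a b j i x = rTrace a b x := by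
  have h1 : ∑ i, ∑ j, (a x)⁻¹ i j * s a b j i x = 0 := h.trace_sMixed hx
  have h2 : ∀ i j, db a b j i x = r a b j i x + s a b j i x := fun i j => by
    rw [r, s]; ring
  simp only [h2, mul_add, Finset.sum_add_distrib, h1, add_zero, rTrace]

end IsMetricOn

end Contractions

open Matrix

/-! ### Geodesic coefficients as solutions of a linear system -/

section GeodesicCoeff

variable {n : ℕ} {U : Set (Coord n)} {a : Coord n → Matrix (Fin n) (Fin n) ℝ}
  {b : Coord n → Fin n → ℝ} {W : Set (Coord n × Coord n)} {x y : Coord n}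

/-- The geodesic coefficients are the solution of a linear system. -/
lemma geodesicCoeff_eq_of_mulVec {F : Coord n → Coord n → ℝ} {g : Matrix (Fin n) (Fin n) ℝ}
    {X : Fin n → ℝ} (hg : fundamentalTensor F x y = g)
    (hpos : ∀ v : Fin n → ℝ, v ≠ 0 → 0 < v ⬝ᵥ g *ᵥ v)
    (hV : ∀ l, (∑ k, pdY l (pdX k (energy F)) x y * y k) - pdX l (energy F) x y
      = 4 * (g *ᵥ X) l) (i : Fin n) : geodesicCoeff F i x y = X i := by
  have hdet : g.det ≠ 0 := by
    intro h0
    obtain ⟨v, hv, hv0⟩ := exists_mulVec_eq_zero_iff.2 h0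
    have := hpos v hv
    simp [hv0] at this
  have h1 : g⁻¹ *ᵥ (g *ᵥ X) = X := by
    rw [mulVec_mulVec, nonsing_inv_mul _ hdet.isUnit, one_mulVec]
  conv_rhs => rw [← h1]
  simp only [geodesicCoeff, hg, hV, mulVec, dotProduct]
  rw [Finset.mul_sum]
  exact Finset.sum_congr rfl fun l _ => by ring

/-- Here `y` meets the last lower index of `Γ`, but the first one in `N`; symmetry of `Γ` reconciles
the two. -/
lemma sum_nonlinConn_mul_eq (h : IsMetricOn U a) (hx : x ∈ U) (l : Fin n) (w : Fin n → ℝ) :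
    ∑ k, (∑ m, christoffel a m l k x * w m) * y k = ∑ m, nonlinConn a m l x y * w m := by
  simp only [nonlinConn, Finset.sum_mul]
  rw [Finset.sum_comm]
  exact Finset.sum_congr rfl fun m _ => Finset.sum_congr rfl fun k _ => by
    rw [h.christoffel_symm hx m l k]; ring

lemma sum_sum_nonlinConn_mul (w : Fin n → ℝ) :
    ∑ k, (∑ m, nonlinConn a m k x y * w m) * y k = 2 * ∑ m, w m * riemannSpray a m x y := by
  simp only [Finset.sum_mul, Finset.mul_sum]
  rw [Finset.sum_comm]
  refine Finset.sum_congr rfl fun m _ => ?_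
  rw [show 2 * (w m * riemannSpray a m x y) = w m * (2 * riemannSpray a m x y) by ring,
    ← sum_nonlinConn_mul, Finset.mul_sum]
  exact Finset.sum_congr rfl fun k _ => by ring

lemma smoothOn_alphaSq (h : IsMetricOn U a) (hWU : ∀ p ∈ W, p.1 ∈ U) : SmoothOn W (alphaSq a) :=
  smoothOn_quadratic (t := fun i j z => a z i j) hWU h.smooth

lemma smoothOn_beta (hb : IsFormOn U b) (hWU : ∀ p ∈ W, p.1 ∈ U) : SmoothOn W (beta b) :=
  smoothOn_linear (w := fun i z => b z i) hWU hb

/-- The geodesic coefficients of a Riemannian metric. -/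
lemma geodesicCoeff_riemannian (h : IsMetricOn U a) (hW : IsOpen W) (hWU : ∀ p ∈ W, p.1 ∈ U)
    {F : Coord n → Coord n → ℝ} (hF : ∀ x y, (x, y) ∈ W → energy F x y = alphaSq a x y)
    (i : Fin n) (hp : (x, y) ∈ W) : geodesicCoeff F i x y = riemannSpray a i x y := by
  have hx := hWU _ hp
  have e1 : ∀ i x y, (x, y) ∈ W → pdY i (energy F) x y = 2 * yLow a i x y := fun i x y hq => by
    rw [pdY_congr hW hF i hq]
    exact HasD.pdY (h.alphaSq_vdir (hWU _ hq) i)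
  have hg : fundamentalTensor F x y = a x := by
    ext i j
    rw [fundamentalTensor, of_apply, pdY_congr hW (e1 i) j hp,
      HasD.pdY ((h.yLow_vdir hx i j).const_mul 2)]
    ring
  have hE : SmoothOn W (energy F) := (smoothOn_alphaSq h hWU).congr fun p hq => hF p.1 p.2 hq
  refine geodesicCoeff_eq_of_mulVec (X := (riemannSpray a · x y)) hg (h.pos x hx) (fun l => ?_) i
  have e2 : ∀ k, pdY l (pdX k (energy F)) x y
      = 2 * (∑ m, christoffel a m l k x * yLow a m x y
        + ∑ m, nonlinConn a m k x y * a x l m) := fun k => by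
    rw [pdY_pdX_comm hW hE k l hp, pdX_congr hW (e1 l) k hp,
      HasD.pdX_of_lifts ((h.yLow_hdir hx l k).const_mul 2)
        (fun m => (h.yLow_vdir hx l m).const_mul 2), mul_add, Finset.mul_sum (a := 2)
        (f := fun m => nonlinConn a m k x y * a x l m)]
    congr 1
    exact Finset.sum_congr rfl fun _ _ => by ring
  have e3 : pdX l (energy F) x y = 2 * ∑ m, nonlinConn a m l x y * yLow a m x y := by
    rw [pdX_congr hW hF l hp, HasD.pdX_of_lifts (h.alphaSq_hdir hx l) (h.alphaSq_vdir hx),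
      Finset.mul_sum, zero_add]
    exact Finset.sum_congr rfl fun _ _ => by ring
  simp only [e2, e3, mul_assoc, ← Finset.mul_sum, add_mul, Finset.sum_add_distrib]
  rw [sum_nonlinConn_mul_eq h hx, sum_sum_nonlinConn_mul]
  simp only [mulVec, dotProduct]
  ring

/-- Half the vertical Hessian of `(α²/β)²`. -/
def kropinaTensor (a : Coord n → Matrix (Fin n) (Fin n) ℝ) (b : Coord n → Fin n → ℝ)
    (x y : Coord n) : Matrix (Fin n) (Fin n) ℝ :=
  (4 / beta b x y ^ 2) • vecMulVec (yLow a · x y) (yLow a · x y)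
    - (4 * alphaSq a x y / beta b x y ^ 3) •
      (vecMulVec (b x) (yLow a · x y) + vecMulVec (yLow a · x y) (b x))
    + (3 * alphaSq a x y ^ 2 / beta b x y ^ 4) • vecMulVec (b x) (b x)
    + (2 * alphaSq a x y / beta b x y ^ 2) • a x

/-- The tensor is a multiple of `a` plus rank-one terms in `y_i` and `b_i`, so beyond `a_{ij}vʲ`
only the scalars `y_i vⁱ` and `b_i vⁱ` matter. -/
lemma kropinaTensor_mulVec (v : Fin n → ℝ) :
    kropinaTensor a b x y *ᵥ v =
      (4 / beta b x y ^ 2 * ((yLow a · x y) ⬝ᵥ v)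
        - 4 * alphaSq a x y / beta b x y ^ 3 * (b x ⬝ᵥ v)) • (yLow a · x y)
      + (3 * alphaSq a x y ^ 2 / beta b x y ^ 4 * (b x ⬝ᵥ v)
        - 4 * alphaSq a x y / beta b x y ^ 3 * ((yLow a · x y) ⬝ᵥ v)) • b x
      + (2 * alphaSq a x y / beta b x y ^ 2) • a x *ᵥ v := by
  simp only [kropinaTensor, add_mulVec, sub_mulVec, smul_mulVec, vecMulVec_mulVec]
  ext i
  simp
  ring

lemma IsMetricOn.cauchy_schwarz (h : IsMetricOn U a) (hx : x ∈ U) (v : Fin n → ℝ)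
    (hA : 0 < alphaSq a x y) :
    ((yLow a · x y) ⬝ᵥ v) ^ 2 ≤ alphaSq a x y * (v ⬝ᵥ a x *ᵥ v) := by
  set A := alphaSq a x y with hAdef
  set p := (yLow a · x y) ⬝ᵥ v with hpdef
  -- This vector is `α²` times the component of `v` orthogonal to `y`; scaling by `α²` avoids a
  -- division.
  have h0 : 0 ≤ (A • v - p • y.ofLp) ⬝ᵥ a x *ᵥ (A • v - p • y.ofLp) := by
    by_cases hz : A • v - p • y.ofLp = 0
    · simp [hz]
    · exact (h.pos x hx _ hz).le
  have e1 : v ⬝ᵥ a x *ᵥ y.ofLp = p := by rw [hpdef, dotProduct_comm]; rfl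
  have e2 : y.ofLp ⬝ᵥ a x *ᵥ v = p := by
    rw [dotProduct_mulVec, ← mulVec_transpose, h.transpose_eq hx]
    rfl
  have e3 : y.ofLp ⬝ᵥ a x *ᵥ y.ofLp = A := by
    rw [hAdef, ← dotProduct_y_yLow, dotProduct_comm]
    rfl
  simp only [mulVec_sub, mulVec_smul, dotProduct_sub, sub_dotProduct, smul_dotProduct,
    dotProduct_smul, smul_eq_mul, e1, e2, e3] at h0
  have h1 : 0 ≤ A * (A * (v ⬝ᵥ a x *ᵥ v) - p ^ 2) := by linarith
  have := nonneg_of_mul_nonneg_right h1 hA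
  linarith

lemma IsMetricOn.alphaSq_pos (h : IsMetricOn U a) (hx : x ∈ U) (hB : 0 < beta b x y) :
    0 < alphaSq a x y := by
  have hy : y.ofLp ≠ 0 := by
    intro h0
    simp [beta, h0] at hB
  have := h.pos x hx _ hy
  rwa [← yLow_eq, dotProduct_comm, dotProduct_y_yLow] at this

lemma IsMetricOn.mulVec_bUp (h : IsMetricOn U a) (hx : x ∈ U) :
    a x *ᵥ (bUp a b · x) = b x := by
  rw [bUp_eq, mulVec_mulVec, h.mul_inv hx, one_mulVec]

lemma IsMetricOn.mulVec_sMixed0 (h : IsMetricOn U a) (hx : x ∈ U) :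
    a x *ᵥ (sMixed0 a b · x y) = (si0 a b · x y) := by
  rw [sMixed0_eq, mulVec_mulVec, h.mul_inv hx, one_mulVec]

lemma IsMetricOn.bSq_pos (h : IsMetricOn U a) (hx : x ∈ U) (hB : 0 < beta b x y) :
    0 < bSq a b x := by
  have hb : (bUp a b · x) ≠ 0 := by
    intro h0
    have h1 := h.mulVec_bUp (b := b) hx
    rw [h0, mulVec_zero] at h1
    simp [beta, ← h1] at hB
  have := h.pos x hx _ hb
  rwa [h.mulVec_bUp hx, dotProduct_comm, dotProduct_b_bUp] at this

/-- Complete the square in `q = b_i vⁱ`. The remainder `2α²|v|² - (4/3)p²`, with `p = y_i vⁱ`, is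
positive because Cauchy-Schwarz gives `p² ≤ α²|v|²` and `4/3 < 2`. -/
lemma kropinaTensor_pos (h : IsMetricOn U a) (hx : x ∈ U) (hB : 0 < beta b x y)
    (v : Fin n → ℝ) (hv : v ≠ 0) : 0 < v ⬝ᵥ kropinaTensor a b x y *ᵥ v := by
  have hA := h.alphaSq_pos hx hB
  have hcs := h.cauchy_schwarz hx v hA
  have hpos := mul_pos hA (h.pos x hx v hv)
  rw [kropinaTensor_mulVec]
  simp only [dotProduct_add, dotProduct_smul, smul_eq_mul, dotProduct_comm v (b x),
    dotProduct_comm v (yLow a · x y)]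
  generalize (yLow a · x y) ⬝ᵥ v = p at *
  generalize b x ⬝ᵥ v = q at *
  generalize v ⬝ᵥ a x *ᵥ v = w at *
  generalize alphaSq a x y = A at *
  generalize beta b x y = B at *
  have h3 : 0 < 2 * (A * w) - (4 / 3) * p ^ 2 := by linarith [sq_nonneg p]
  have e : (4 / B ^ 2 * p - 4 * A / B ^ 3 * q) * p + (3 * A ^ 2 / B ^ 4 * q - 4 * A / B ^ 3 * p) * q
      + 2 * A / B ^ 2 * w
      = (2 * (A * w) - (4 / 3) * p ^ 2 + 3 * (A * q / B - 4 / 3 * p) ^ 2) / B ^ 2 := by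
    field_simp
    ring
  rw [e]
  positivity

end GeodesicCoeff

/-! ### The spray of the Kropina metric -/

section Kropina

variable {n : ℕ} {U : Set (Coord n)} {a : Coord n → Matrix (Fin n) (Fin n) ℝ}
  {b : Coord n → Fin n → ℝ} {W : Set (Coord n × Coord n)} {x y : Coord n}
  {v : Coord n × Coord n} {dA dB : ℝ}

lemma HasD.kropina_sq (hA : HasD (fun q => alphaSq a q.1 q.2) (x, y) v dA)
    (hB : HasD (fun q => beta b q.1 q.2) (x, y) v dB) (h0 : beta b x y ≠ 0) :
    HasD (fun q => (alphaSq a q.1 q.2 / beta b q.1 q.2) ^ 2) (x, y) v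
      (dA * (2 * alphaSq a x y / beta b x y ^ 2)
        - dB * (2 * alphaSq a x y ^ 2 / beta b x y ^ 3)) := by
  simp only [sq (_ / _)]
  refine ((hA.div hB h0).mul (hA.div hB h0)).congr_val ?_
  field_simp
  ring

/-- The vertical gradient of `(α²/β)²`. -/
def kropinaGrad (a : Coord n → Matrix (Fin n) (Fin n) ℝ) (b : Coord n → Fin n → ℝ)
    (i : Fin n) (x y : Coord n) : ℝ :=
  4 * (alphaSq a x y * yLow a i x y / beta b x y ^ 2)
    - 2 * (alphaSq a x y ^ 2 * b x i / beta b x y ^ 3)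

lemma HasD.kropinaGrad {i : Fin n} {dy db : ℝ}
    (hA : HasD (fun q => alphaSq a q.1 q.2) (x, y) v dA)
    (hB : HasD (fun q => beta b q.1 q.2) (x, y) v dB)
    (hy : HasD (fun q => yLow a i q.1 q.2) (x, y) v dy)
    (hb : HasD (fun q => b q.1 i) (x, y) v db) (h0 : beta b x y ≠ 0) :
    HasD (fun q => kropinaGrad a b i q.1 q.2) (x, y) v
      (dA * (4 * yLow a i x y / beta b x y ^ 2 - 4 * alphaSq a x y * b x i / beta b x y ^ 3)
        + dB * (6 * alphaSq a x y ^ 2 * b x i / beta b x y ^ 4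
          - 8 * alphaSq a x y * yLow a i x y / beta b x y ^ 3)
        + dy * (4 * alphaSq a x y / beta b x y ^ 2)
        - db * (2 * alphaSq a x y ^ 2 / beta b x y ^ 3)) := by
  simp only [Finsler.kropinaGrad, pow_succ, pow_zero, one_mul]
  refine ((((hA.mul hy).div (hB.mul hB) (mul_ne_zero h0 h0)).const_mul 4).sub
    ((((hA.mul hA).mul hb).div ((hB.mul hB).mul hB)
      (mul_ne_zero (mul_ne_zero h0 h0) h0)).const_mul 2)).congr_val ?_
  field_simp
  ring

/-- The coefficient of `bⁱ` in the Kropina spray. -/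
def kropinaP (a : Coord n → Matrix (Fin n) (Fin n) ℝ) (b : Coord n → Fin n → ℝ)
    (x y : Coord n) : ℝ :=
  (alphaSq a x y / beta b x y * s0 a b x y + r00 a b x y) / (2 * bSq a b x)

/-- The coefficient of `-yⁱ` in the Kropina spray. -/
def kropinaQ (a : Coord n → Matrix (Fin n) (Fin n) ℝ) (b : Coord n → Fin n → ℝ)
    (x y : Coord n) : ℝ :=
  (s0 a b x y + beta b x y / alphaSq a x y * r00 a b x y) / bSq a b x

/-- The coefficient of `-sⁱ_0` in the Kropina spray. -/
def kropinaC (a : Coord n → Matrix (Fin n) (Fin n) ℝ) (b : Coord n → Fin n → ℝ)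
    (x y : Coord n) : ℝ := alphaSq a x y / (2 * beta b x y)

/-- The difference of the geodesic coefficients of `α²/β` and `α`. -/
def kropinaH (a : Coord n → Matrix (Fin n) (Fin n) ℝ) (b : Coord n → Fin n → ℝ)
    (i : Fin n) (x y : Coord n) : ℝ :=
  kropinaP a b x y * bUp a b i x - kropinaC a b x y * sMixed0 a b i x y
    - kropinaQ a b x y * y i

/-- The domain `β > 0` of the Kropina metric over `U`. -/
def kropinaDomain (U : Set (Coord n)) (b : Coord n → Fin n → ℝ) : Set (Coord n × Coord n) :=
  {p | p.1 ∈ U ∧ 0 < beta b p.1 p.2}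

lemma isOpen_kropinaDomain (hU : IsOpen U) (hb : IsFormOn U b) : IsOpen (kropinaDomain U b) := by
  have h1 : IsOpen (Prod.fst ⁻¹' U : Set (Coord n × Coord n)) := hU.preimage continuous_fst
  have h2 : ContinuousOn (Function.uncurry (beta b)) (Prod.fst ⁻¹' U) :=
    (smoothOn_beta hb fun _ hp => hp).continuousOn
  exact h2.isOpen_inter_preimage h1 isOpen_Ioi

/-- The right-hand side is what remains of the geodesic system once the `Γ`-terms are removed. The
scalars `P`, `C`, `Q` are those for which the coefficients of `y_l`, `b_l` and `s_{l0}` match. -/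
lemma kropinaTensor_mulVec_kropinaH (h : IsMetricOn U a) (hx : x ∈ U) (hB : 0 < beta b x y)
    (l : Fin n) : 4 * (kropinaTensor a b x y *ᵥ (kropinaH a b · x y)) l =
      r00 a b x y * (6 * alphaSq a x y ^ 2 * b x l / beta b x y ^ 4
          - 8 * alphaSq a x y * yLow a l x y / beta b x y ^ 3)
        - 4 * alphaSq a x y ^ 2 / beta b x y ^ 3 * si0 a b l x y := by
  have hA := (h.alphaSq_pos hx hB).ne'
  have hb2 := (h.bSq_pos hx hB).ne'
  have hB0 := hB.ne'
  have hH : (kropinaH a b · x y) = kropinaP a b x y • (bUp a b · x)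
      - kropinaC a b x y • (sMixed0 a b · x y) - kropinaQ a b x y • y.ofLp := by
    ext i; simp [kropinaH]
  rw [kropinaTensor_mulVec, hH]
  simp only [mulVec_sub, mulVec_smul, h.mulVec_bUp hx, h.mulVec_sMixed0 hx, ← yLow_eq,
    dotProduct_sub, dotProduct_smul, h.dotProduct_yLow_bUp hx, h.dotProduct_yLow_sMixed0 hx,
    dotProduct_y_yLow, dotProduct_b_bUp, h.dotProduct_b_sMixed0 hx, dotProduct_b_y,
    Pi.add_apply, Pi.sub_apply, Pi.smul_apply, smul_eq_mul, kropinaP, kropinaC, kropinaQ]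
  field_simp
  ring

/-- The geodesic coefficients of the Kropina metric `α²/β`. -/
lemma geodesicCoeff_kropina (h : IsMetricOn U a) (hb : IsFormOn U b) {F : Coord n → Coord n → ℝ}
    (hF : ∀ x y, (x, y) ∈ kropinaDomain U b →
      energy F x y = (alphaSq a x y / beta b x y) ^ 2)
    (i : Fin n) (hp : (x, y) ∈ kropinaDomain U b) :
    geodesicCoeff F i x y = riemannSpray a i x y + kropinaH a b i x y := by
  have hW := isOpen_kropinaDomain h.isOpen hb
  have hWU : ∀ p ∈ kropinaDomain U b, p.1 ∈ U := fun p hp => hp.1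
  have hx := hWU _ hp
  have hB : 0 < beta b x y := hp.2
  have hEv : ∀ i x y, (x, y) ∈ kropinaDomain U b →
      HasD (fun q => (alphaSq a q.1 q.2 / beta b q.1 q.2) ^ 2) (x, y) (vdir i)
        (kropinaGrad a b i x y) := fun i x y hq => by
    refine (HasD.kropina_sq (h.alphaSq_vdir hq.1 i) (h.beta_vdir hb hq.1 i)
      (ne_of_gt hq.2)).congr_val ?_
    rw [kropinaGrad]
    ring
  have e1 : ∀ i x y, (x, y) ∈ kropinaDomain U b →
      pdY i (energy F) x y = kropinaGrad a b i x y := fun i x y hq => by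
    rw [pdY_congr hW hF i hq]
    exact HasD.pdY (hEv i x y hq)
  have hGv : ∀ i j, HasD (fun q => kropinaGrad a b i q.1 q.2) (x, y) (vdir j)
      (2 * kropinaTensor a b x y i j) := fun i j => by
    refine (HasD.kropinaGrad (h.alphaSq_vdir hx j) (h.beta_vdir hb hx j) (h.yLow_vdir hx i j)
      (h.form_vdir hb hx i j) hB.ne').congr_val ?_
    simp only [kropinaTensor, vecMulVec, Matrix.add_apply, Matrix.sub_apply, Matrix.smul_apply,
      of_apply, smul_eq_mul]
    ring
  have hg : fundamentalTensor F x y = kropinaTensor a b x y := by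
    ext i j
    rw [fundamentalTensor, of_apply, pdY_congr hW (e1 i) j hp, HasD.pdY (hGv i j)]
    ring
  have hE : SmoothOn (kropinaDomain U b) (energy F) := by
    refine ContDiffOn.congr ?_ fun p hq => hF p.1 p.2 hq
    exact (((smoothOn_alphaSq h hWU).div (smoothOn_beta hb hWU)
      fun p hq => (ne_of_gt hq.2)).pow 2)
  refine geodesicCoeff_eq_of_mulVec (X := fun i => riemannSpray a i x y + kropinaH a b i x y)
    hg (kropinaTensor_pos h hx hB) (fun l => ?_) i
  -- After contraction with `yᵏ` the Christoffel sum cancels the `N`-term of `e3`, and the `N`-sum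
  -- becomes `4 g_{lm} Gᵐ` with `G` the spray of `α`; only the `r` and `s` terms are left for `H`.
  have e2 : ∀ k, pdY l (pdX k (energy F)) x y
      = (r0k a b k x y - si0 a b k x y) * (6 * alphaSq a x y ^ 2 * b x l / beta b x y ^ 4
          - 8 * alphaSq a x y * yLow a l x y / beta b x y ^ 3)
        - db a b l k x * (2 * alphaSq a x y ^ 2 / beta b x y ^ 3)
        + ∑ m, christoffel a m l k x * kropinaGrad a b m x y
        + ∑ m, nonlinConn a m k x y * (2 * kropinaTensor a b x y l m) := fun k => by
    rw [pdY_pdX_comm hW hE k l hp, pdX_congr hW (e1 l) k hp,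
      HasD.pdX_of_lifts (HasD.kropinaGrad (h.alphaSq_hdir hx k) (h.beta_hdir hb hx k)
        (h.yLow_hdir hx l k) (h.form_hdir hb hx l k) hB.ne') (hGv l)]
    have : ∑ m, christoffel a m l k x * kropinaGrad a b m x y
        = (∑ m, christoffel a m l k x * yLow a m x y) * (4 * alphaSq a x y / beta b x y ^ 2)
          - (∑ m, christoffel a m l k x * b x m)
            * (2 * alphaSq a x y ^ 2 / beta b x y ^ 3) := by
      simp only [kropinaGrad, Finset.sum_mul, ← Finset.sum_sub_distrib]
      exact Finset.sum_congr rfl fun _ _ => by ring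
    rw [this]
    ring
  have e3 : pdX l (energy F) x y = -((r0k a b l x y - si0 a b l x y)
      * (2 * alphaSq a x y ^ 2 / beta b x y ^ 3))
      + ∑ m, nonlinConn a m l x y * kropinaGrad a b m x y := by
    rw [pdX_congr hW hF l hp, HasD.pdX_of_lifts (HasD.kropina_sq (h.alphaSq_hdir hx l)
      (h.beta_hdir hb hx l) hB.ne') (fun m => hEv m x y hp)]
    ring
  have t1 : ∀ c : ℝ, ∑ k, (r0k a b k x y - si0 a b k x y) * c * y k = r00 a b x y * c :=
    fun c => by
      have e4 : ((r0k a b · x y) - (si0 a b · x y)) ⬝ᵥ y.ofLp = r00 a b x y := by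
        rw [sub_dotProduct, dotProduct_r0k_y, dotProduct_si0_y, sub_zero]
      rw [← e4, dotProduct, Finset.sum_mul]
      exact Finset.sum_congr rfl fun k _ => by simp only [Pi.sub_apply]; ring
  have t2 : ∀ c : ℝ, ∑ k, db a b l k x * c * y k = (r0k a b l x y + si0 a b l x y) * c :=
    fun c => by
      rw [r0k, si0, ← Finset.sum_add_distrib, Finset.sum_mul]
      exact Finset.sum_congr rfl fun k _ => by rw [r, s]; ring
  have t4 : ∀ c d : ℝ, ∑ k, ((r0k a b k x y - si0 a b k x y) * c - db a b l k x * d) * y k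
      = r00 a b x y * c - (r0k a b l x y + si0 a b l x y) * d := fun c d => by
    rw [← t1, ← t2, ← Finset.sum_sub_distrib]
    exact Finset.sum_congr rfl fun _ _ => by ring
  simp only [e2, e3, add_mul, Finset.sum_add_distrib, t4]
  rw [sum_nonlinConn_mul_eq h hx, sum_sum_nonlinConn_mul]
  have t3 : (kropinaTensor a b x y *ᵥ fun i => riemannSpray a i x y + kropinaH a b i x y) l
      = ∑ m, kropinaTensor a b x y l m * riemannSpray a m x y
        + (kropinaTensor a b x y *ᵥ (kropinaH a b · x y)) l := by
    simp only [mulVec, dotProduct, mul_add, Finset.sum_add_distrib]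
  rw [t3, mul_add, kropinaTensor_mulVec_kropinaH h hx hB l]
  simp only [mul_assoc, ← Finset.mul_sum]
  ring

end Kropina

/-! ### The Ricci curvature in coordinates -/

section RicciKropina

variable {n : ℕ} {U : Set (Coord n)} {a : Coord n → Matrix (Fin n) (Fin n) ℝ}
  {b : Coord n → Fin n → ℝ} {x y : Coord n}

/-- The left side is the trace of the square of `β pᵀ - σ cᵀ - C S - η qᵀ - Q I`. Expanding and
using cyclicity of the trace reduces each product with a rank-one factor to dot products. -/
lemma sum_sum_mul_swap (S : Matrix (Fin n) (Fin n) ℝ) (β p σ c η q : Fin n → ℝ) (C Q : ℝ) :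
    ∑ i, ∑ m, (p m * β i - c m * σ i - C * S i m - q m * η i - Q * if i = m then 1 else 0)
        * (p i * β m - c i * σ m - C * S m i - q i * η m - Q * if m = i then 1 else 0)
      = (p ⬝ᵥ β) ^ 2 + (c ⬝ᵥ σ) ^ 2 + (q ⬝ᵥ η) ^ 2 + C ^ 2 * (∑ i, ∑ m, S i m * S m i)
        + Q ^ 2 * n - 2 * (p ⬝ᵥ σ) * (c ⬝ᵥ β) - 2 * (p ⬝ᵥ η) * (q ⬝ᵥ β)
        + 2 * (c ⬝ᵥ η) * (q ⬝ᵥ σ) - 2 * C * (p ⬝ᵥ S *ᵥ β) + 2 * C * (c ⬝ᵥ S *ᵥ σ)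
        + 2 * C * (q ⬝ᵥ S *ᵥ η) - 2 * Q * (p ⬝ᵥ β) + 2 * Q * (c ⬝ᵥ σ) + 2 * Q * (q ⬝ᵥ η)
        + 2 * C * Q * S.trace := by
  set M : Matrix (Fin n) (Fin n) ℝ :=
    vecMulVec β p - vecMulVec σ c - C • S - vecMulVec η q - Q • 1 with hM
  have h1 : ∀ i m, M i m
      = p m * β i - c m * σ i - C * S i m - q m * η i - Q * if i = m then 1 else 0 := by
    intro i m
    simp only [hM, Matrix.sub_apply, Matrix.smul_apply, vecMulVec_apply, Matrix.one_apply,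
      smul_eq_mul]
    ring
  have h2 : (M * M).trace = ∑ i, ∑ m, M i m * M m i := by
    simp only [trace, diag_apply, Matrix.mul_apply]
  have h3 : (S * S).trace = ∑ i, ∑ m, S i m * S m i := by
    simp only [trace, diag_apply, Matrix.mul_apply]
  have hl : ∀ u w : Fin n → ℝ, (S * vecMulVec u w).trace = w ⬝ᵥ S *ᵥ u := fun u w => by
    rw [mul_vecMulVec, trace_vecMulVec, dotProduct_comm]
  have hr : ∀ u w : Fin n → ℝ, (vecMulVec u w * S).trace = w ⬝ᵥ S *ᵥ u := fun u w => by
    rw [trace_mul_comm, hl]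
  have hv : ∀ u w u' w' : Fin n → ℝ, (vecMulVec u w * vecMulVec u' w').trace
      = (w ⬝ᵥ u') * (w' ⬝ᵥ u) := fun u w u' w' => by
    rw [vecMulVec_mul_vecMulVec]
    simp [trace_smul, trace_vecMulVec, dotProduct_comm u]
  simp only [← h1]
  rw [← h2, ← h3, hM]
  simp only [Matrix.sub_mul, Matrix.mul_sub, Matrix.smul_mul, Matrix.mul_smul, Matrix.one_mul,
    Matrix.mul_one, trace_sub, trace_smul, hl, hr, hv, trace_vecMulVec, trace_one,
    Fintype.card_fin, smul_eq_mul, dotProduct_comm β p, dotProduct_comm σ c, dotProduct_comm η q]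
  ring

section Gradients

variable (a b x y) (dA dB ds dr0 dr db : Fin n → ℝ)

/-- The gradient of `kropinaP` in terms of those of `α²`, `β`, `s_0`, `r_{00}`, `b²`. -/
def gradP : Fin n → ℝ :=
  (s0 a b x y / (2 * beta b x y * bSq a b x)) • dA
    - (alphaSq a x y * s0 a b x y / (2 * beta b x y ^ 2 * bSq a b x)) • dB
    + (alphaSq a x y / (2 * beta b x y * bSq a b x)) • ds
    + (1 / (2 * bSq a b x)) • dr - (kropinaP a b x y / bSq a b x) • db

/-- The gradient of `kropinaQ` in terms of those of `α²`, `β`, `s_0`, `r_{00}`, `b²`. -/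
def gradQ : Fin n → ℝ :=
  (r00 a b x y / (alphaSq a x y * bSq a b x)) • dB
    - (beta b x y * r00 a b x y / (alphaSq a x y ^ 2 * bSq a b x)) • dA
    + (1 / bSq a b x) • ds + (beta b x y / (alphaSq a x y * bSq a b x)) • dr
    - (kropinaQ a b x y / bSq a b x) • db

/-- The gradient of `kropinaC` in terms of those of `α²`, `β`. -/
def gradC : Fin n → ℝ :=
  (1 / (2 * beta b x y)) • dA - (alphaSq a x y / (2 * beta b x y ^ 2)) • dB

/-- The vertical divergence of `kropinaH`. -/
def kropinaD (x y : Coord n) : ℝ :=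
  (r0 a b x y - n * s0 a b x y - (n + 1) * (beta b x y / alphaSq a x y * r00 a b x y))
    / bSq a b x

/-- The gradient of `kropinaD` in terms of those of `α²`, `β`, `s_0`, `r_0`, `r_{00}`, `b²`. -/
def gradD : Fin n → ℝ :=
  ((n + 1) * beta b x y * r00 a b x y / (alphaSq a x y ^ 2 * bSq a b x)) • dA
    - ((n + 1) * r00 a b x y / (alphaSq a x y * bSq a b x)) • dB
    - (n / bSq a b x) • ds + (1 / bSq a b x) • dr0
    - ((n + 1) * beta b x y / (alphaSq a x y * bSq a b x)) • dr
    - (kropinaD a b x y / bSq a b x) • db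

variable {a b x y dA dB ds dr0 dr db} {v : Coord n × Coord n} {k : Fin n}

section

variable (hA : HasD (fun q => alphaSq a q.1 q.2) (x, y) v (dA k))
  (hB : HasD (fun q => beta b q.1 q.2) (x, y) v (dB k))
  (hs : HasD (fun q => s0 a b q.1 q.2) (x, y) v (ds k))
  (hr0 : HasD (fun q => r0 a b q.1 q.2) (x, y) v (dr0 k))
  (hr : HasD (fun q => r00 a b q.1 q.2) (x, y) v (dr k))
  (hb : HasD (fun q => bSq a b q.1) (x, y) v (db k))
  (hA0 : alphaSq a x y ≠ 0) (hB0 : beta b x y ≠ 0) (hb0 : bSq a b x ≠ 0)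

include hA hB hs hr hb hB0 hb0 in
-- The direction is left arbitrary here and in the three lemmas that follow, so that one computation
-- serves both the horizontal and the vertical gradients.
lemma HasD.kropinaP :
    HasD (fun q => kropinaP a b q.1 q.2) (x, y) v (gradP a b x y dA dB ds dr db k) := by
  simp only [Finsler.kropinaP]
  refine ((((hA.div hB hB0).mul hs).add hr).div (hb.const_mul 2)
    (mul_ne_zero two_ne_zero hb0)).congr_val ?_
  simp only [gradP, Finsler.kropinaP, Pi.add_apply, Pi.sub_apply, Pi.smul_apply, smul_eq_mul]
  field_simp

include hA hB hs hr hb hA0 hb0 in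
lemma HasD.kropinaQ :
    HasD (fun q => kropinaQ a b q.1 q.2) (x, y) v (gradQ a b x y dA dB ds dr db k) := by
  simp only [Finsler.kropinaQ]
  refine ((hs.add ((hB.div hA hA0).mul hr)).div hb hb0).congr_val ?_
  simp only [gradQ, Finsler.kropinaQ, Pi.add_apply, Pi.sub_apply, Pi.smul_apply, smul_eq_mul]
  field_simp
  ring

include hA hB hB0 in
lemma HasD.kropinaC :
    HasD (fun q => kropinaC a b q.1 q.2) (x, y) v (gradC a b x y dA dB k) := by
  simp only [Finsler.kropinaC]
  refine (hA.div (hB.const_mul 2) (mul_ne_zero two_ne_zero hB0)).congr_val ?_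
  simp only [gradC, Pi.sub_apply, Pi.smul_apply, smul_eq_mul]
  field_simp

include hA hB hs hr0 hr hb hA0 hb0 in
lemma HasD.kropinaD :
    HasD (fun q => kropinaD a b q.1 q.2) (x, y) v (gradD a b x y dA dB ds dr0 dr db k) := by
  simp only [Finsler.kropinaD]
  refine (((hr0.sub (hs.const_mul n)).sub
    (((hB.div hA hA0).mul hr).const_mul (n + 1))).div hb hb0).congr_val ?_
  simp only [gradD, Finsler.kropinaD, Pi.add_apply, Pi.sub_apply, Pi.smul_apply, smul_eq_mul]
  field_simp
  ring

end

end Gradients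

variable (a b x y)

/-- The horizontal gradient of `kropinaP`. -/
def hgradP : Fin n → ℝ := gradP a b x y 0 ((r0k a b · x y) - (si0 a b · x y))
  (s0Cov a b · x y) (r00Cov a b · x y) ((2 : ℝ) • ((rLow a b · x) + (sLow a b · x)))

/-- The vertical gradient of `kropinaP`. -/
def vgradP : Fin n → ℝ := gradP a b x y ((2 : ℝ) • (yLow a · x y)) (b x)
  (sLow a b · x) ((2 : ℝ) • (r0k a b · x y)) 0

/-- The horizontal gradient of `kropinaQ`. -/
def hgradQ : Fin n → ℝ := gradQ a b x y 0 ((r0k a b · x y) - (si0 a b · x y))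
  (s0Cov a b · x y) (r00Cov a b · x y) ((2 : ℝ) • ((rLow a b · x) + (sLow a b · x)))

/-- The vertical gradient of `kropinaQ`. -/
def vgradQ : Fin n → ℝ := gradQ a b x y ((2 : ℝ) • (yLow a · x y)) (b x)
  (sLow a b · x) ((2 : ℝ) • (r0k a b · x y)) 0

/-- The horizontal gradient of `kropinaC`. -/
def hgradC : Fin n → ℝ := gradC a b x y 0 ((r0k a b · x y) - (si0 a b · x y))

/-- The vertical gradient of `kropinaC`. -/
def vgradC : Fin n → ℝ := gradC a b x y ((2 : ℝ) • (yLow a · x y)) (b x)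

/-- The horizontal gradient of `kropinaD`. -/
def hgradD : Fin n → ℝ := gradD a b x y 0 ((r0k a b · x y) - (si0 a b · x y))
  (s0Cov a b · x y) (r0Cov a b · x y) (r00Cov a b · x y)
  ((2 : ℝ) • ((rLow a b · x) + (sLow a b · x)))

/-- The vertical gradient of `kropinaD`. -/
def vgradD : Fin n → ℝ := gradD a b x y ((2 : ℝ) • (yLow a · x y)) (b x)
  (sLow a b · x) (rLow a b · x) ((2 : ℝ) • (r0k a b · x y)) 0

variable {a b x y}

namespace IsMetricOn

variable (h : IsMetricOn U a) (hb : IsFormOn U b) (hp : (x, y) ∈ kropinaDomain U b)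
include h hb hp

/-- The factors `bⁱ`, `sⁱ_0` and `yⁱ` each carry a free upper index and hence the same Christoffel
defect; collected, it is the one that `sprayRicci_add` expects, and the bracket is the `i`-th
summand of `Hⁱ_{|i}`. -/
lemma kropinaH_hdir (i : Fin n) : HasD (fun q => kropinaH a b i q.1 q.2) (x, y) (hdir a x y i)
    ((hgradP a b x y i * bUp a b i x
        + kropinaP a b x y * ∑ j, (a x)⁻¹ i j * db a b j i x
        - hgradC a b x y i * sMixed0 a b i x y
        - kropinaC a b x y * ∑ j, covMixed a (sMixed a b) i j i x * y j
        - hgradQ a b x y i * y i)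
      - ∑ m, christoffel a i m i x * kropinaH a b m x y) := by
  have hx : x ∈ U := hp.1
  have hB : 0 < beta b x y := hp.2
  have hA0 := (h.alphaSq_pos hx hB).ne'
  have hb0 := (h.bSq_pos hx hB).ne'
  have hP : HasD (fun q => kropinaP a b q.1 q.2) (x, y) (hdir a x y i) (hgradP a b x y i) :=
    HasD.kropinaP (h.alphaSq_hdir hx i) (h.beta_hdir hb hx i) (h.s0_hdir hb hx i)
      (h.r00_hdir hb hx i) (h.bSq_hdir hb hx i) hB.ne' hb0
  have hC : HasD (fun q => kropinaC a b q.1 q.2) (x, y) (hdir a x y i) (hgradC a b x y i) :=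
    HasD.kropinaC (h.alphaSq_hdir hx i) (h.beta_hdir hb hx i) hB.ne'
  have hQ : HasD (fun q => kropinaQ a b q.1 q.2) (x, y) (hdir a x y i) (hgradQ a b x y i) :=
    HasD.kropinaQ (h.alphaSq_hdir hx i) (h.beta_hdir hb hx i) (h.s0_hdir hb hx i)
      (h.r00_hdir hb hx i) (h.bSq_hdir hb hx i) hA0 hb0
  refine (((hP.mul (h.bUp_hdir hb hx i i)).sub (hC.mul (h.sMixed0_hdir hb hx i i))).sub
    (hQ.mul (HasD.snd_hdir i i))).congr_val ?_
  have e : ∑ m, christoffel a i m i x * kropinaH a b m x y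
      = kropinaP a b x y * (∑ m, christoffel a i m i x * bUp a b m x)
        - kropinaC a b x y * (∑ m, christoffel a i m i x * sMixed0 a b m x y)
        - kropinaQ a b x y * nonlinConn a i i x y := by
    simp only [kropinaH, nonlinConn, Finset.mul_sum, ← Finset.sum_sub_distrib]
    exact Finset.sum_congr rfl fun _ _ => by ring
  rw [e]
  ring

lemma kropinaH_vdir (i m : Fin n) : HasD (fun q => kropinaH a b i q.1 q.2) (x, y) (vdir m)
    (vgradP a b x y m * bUp a b i x - vgradC a b x y m * sMixed0 a b i x y
      - kropinaC a b x y * (Matrix.of fun i j => sMixed a b i j x) i m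
      - vgradQ a b x y m * y i - kropinaQ a b x y * if i = m then 1 else 0) := by
  have hx : x ∈ U := hp.1
  have hB : 0 < beta b x y := hp.2
  have hA0 := (h.alphaSq_pos hx hB).ne'
  have hb0 := (h.bSq_pos hx hB).ne'
  have hP : HasD (fun q => kropinaP a b q.1 q.2) (x, y) (vdir m) (vgradP a b x y m) :=
    HasD.kropinaP (h.alphaSq_vdir hx m) (h.beta_vdir hb hx m) (h.s0_vdir hb hx m)
      (h.r00_vdir hb hx m) (h.bSq_vdir hb hx m) hB.ne' hb0
  have hC : HasD (fun q => kropinaC a b q.1 q.2) (x, y) (vdir m) (vgradC a b x y m) :=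
    HasD.kropinaC (h.alphaSq_vdir hx m) (h.beta_vdir hb hx m) hB.ne'
  have hQ : HasD (fun q => kropinaQ a b q.1 q.2) (x, y) (vdir m) (vgradQ a b x y m) :=
    HasD.kropinaQ (h.alphaSq_vdir hx m) (h.beta_vdir hb hx m) (h.s0_vdir hb hx m)
      (h.r00_vdir hb hx m) (h.bSq_vdir hb hx m) hA0 hb0
  refine (((hP.mul (h.bUp_vdir hb hx i m)).sub (hC.mul (h.sMixed0_vdir hb hx i m))).sub
    (hQ.mul (HasD.snd_vdir i m))).congr_val ?_
  simp only [of_apply]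
  ring

lemma kropinaD_hdir (k : Fin n) :
    HasD (fun q => kropinaD a b q.1 q.2) (x, y) (hdir a x y k) (hgradD a b x y k) :=
  have hx : x ∈ U := hp.1
  HasD.kropinaD (h.alphaSq_hdir hx k) (h.beta_hdir hb hx k) (h.s0_hdir hb hx k)
    (h.r0_hdir hb hx k) (h.r00_hdir hb hx k) (h.bSq_hdir hb hx k)
    (h.alphaSq_pos hx hp.2).ne' (h.bSq_pos hx hp.2).ne'

lemma kropinaD_vdir (k : Fin n) :
    HasD (fun q => kropinaD a b q.1 q.2) (x, y) (vdir k) (vgradD a b x y k) :=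
  have hx : x ∈ U := hp.1
  HasD.kropinaD (h.alphaSq_vdir hx k) (h.beta_vdir hb hx k) (h.s0_vdir hb hx k)
    (h.r0_vdir hb hx k) (h.r00_vdir hb hx k) (h.bSq_vdir hb hx k)
    (h.alphaSq_pos hx hp.2).ne' (h.bSq_pos hx hp.2).ne'

/-- The contraction table collapses the divergence to `s_0`, `r_0`, `r_00` over `b²`. This short
form is what gets differentiated again. -/
lemma vdiv_kropinaH : vdiv (kropinaH a b) x y = kropinaD a b x y := by
  have hx : x ∈ U := hp.1
  have hB : 0 < beta b x y := hp.2
  have hA0 := (h.alphaSq_pos hx hB).ne'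
  have hb0 := (h.bSq_pos hx hB).ne'
  have hB0 := hB.ne'
  have e : vdiv (kropinaH a b) x y = vgradP a b x y ⬝ᵥ (bUp a b · x)
      - vgradC a b x y ⬝ᵥ (sMixed0 a b · x y)
      - kropinaC a b x y * (Matrix.of fun i j => sMixed a b i j x).trace
      - vgradQ a b x y ⬝ᵥ y.ofLp - kropinaQ a b x y * n := by
    have h1 : ∀ i, pdY i (kropinaH a b i) x y = _ := fun i =>
      HasD.pdY (h.kropinaH_vdir hb hp i i)
    simp only [vdiv, h1, Finset.sum_sub_distrib, trace, diag_apply, dotProduct, Finset.mul_sum]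
    simp
    ring
  rw [e, h.trace_sMixed hx]
  simp only [vgradP, vgradC, vgradQ, gradP, gradQ, gradC, add_dotProduct, sub_dotProduct,
    smul_dotProduct, smul_eq_mul, zero_dotProduct, h.dotProduct_yLow_bUp hx,
    h.dotProduct_yLow_sMixed0 hx, dotProduct_y_yLow, dotProduct_b_bUp,
    h.dotProduct_b_sMixed0 hx, dotProduct_b_y, dotProduct_sLow_bUp, dotProduct_sLow_y,
    dotProduct_r0k_bUp, dotProduct_r0k_y, kropinaD, kropinaQ]
  field_simp
  ring

omit hp in
lemma smoothOn_kropinaH (i : Fin n) : SmoothOn (kropinaDomain U b) (kropinaH a b i) := by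
  have hWU : ∀ p ∈ kropinaDomain U b, p.1 ∈ U := fun p hp => hp.1
  have hA := smoothOn_alphaSq h hWU
  have hB := smoothOn_beta hb hWU
  have hs : SmoothOn (kropinaDomain U b) (s0 a b) := smoothOn_linear hWU (h.smooth_sLow hb)
  have hr : SmoothOn (kropinaDomain U b) (r00 a b) := smoothOn_quadratic hWU (h.smooth_r hb)
  have hS : SmoothOn (kropinaDomain U b) (sMixed0 a b i) :=
    smoothOn_linear hWU (h.smooth_sMixed hb i)
  have hb2 := smoothOn_fst hWU (h.smooth_bSq hb)
  have hbU := smoothOn_fst hWU (h.smooth_bUp hb i)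
  have hA0 : ∀ p ∈ kropinaDomain U b, alphaSq a p.1 p.2 ≠ 0 :=
    fun p hp => (h.alphaSq_pos hp.1 hp.2).ne'
  have hB0 : ∀ p ∈ kropinaDomain U b, beta b p.1 p.2 ≠ 0 := fun p hp => ne_of_gt hp.2
  have hb0 : ∀ p ∈ kropinaDomain U b, bSq a b p.1 ≠ 0 :=
    fun p hp => (h.bSq_pos hp.1 hp.2).ne'
  have hP : SmoothOn (kropinaDomain U b) (kropinaP a b) :=
    (((hA.div hB hB0).mul hs).add hr).div (contDiffOn_const.mul hb2)
      fun p hp => mul_ne_zero two_ne_zero (hb0 p hp)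
  have hQ : SmoothOn (kropinaDomain U b) (kropinaQ a b) :=
    (hs.add ((hB.div hA hA0).mul hr)).div hb2 hb0
  have hC : SmoothOn (kropinaDomain U b) (kropinaC a b) :=
    hA.div (contDiffOn_const.mul hB) fun p hp => mul_ne_zero two_ne_zero (hB0 p hp)
  exact ((hP.mul hbU).sub (hC.mul hS)).sub (hQ.mul (smoothOn_snd i))

omit hb in
/-- The contribution of `kropinaH` to the Ricci curvature. -/
lemma kropinaT_eq :
    2 * (∑ i, (hgradP a b x y i * bUp a b i x
        + kropinaP a b x y * ∑ j, (a x)⁻¹ i j * db a b j i x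
        - hgradC a b x y i * sMixed0 a b i x y
        - kropinaC a b x y * ∑ j, covMixed a (sMixed a b) i j i x * y j
        - hgradQ a b x y i * y i))
      - (∑ k, hgradD a b x y k * y k)
      + 2 * (∑ m, kropinaH a b m x y * vgradD a b x y m)
      - ∑ i, ∑ m,
        (vgradP a b x y m * bUp a b i x - vgradC a b x y m * sMixed0 a b i x y
          - kropinaC a b x y * (Matrix.of fun i j => sMixed a b i j x) i m
          - vgradQ a b x y m * y i - kropinaQ a b x y * if i = m then 1 else 0)
        * (vgradP a b x y i * bUp a b m x - vgradC a b x y i * sMixed0 a b m x y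
          - kropinaC a b x y * (Matrix.of fun i j => sMixed a b i j x) m i
          - vgradQ a b x y i * y m - kropinaQ a b x y * if m = i then 1 else 0)
      = kropinaT a b x y := by
  have hx : x ∈ U := hp.1
  have hB : 0 < beta b x y := hp.2
  have hA0 := (h.alphaSq_pos hx hB).ne'
  have hb0 := (h.bSq_pos hx hB).ne'
  have hB0 := hB.ne'
  have e1 : ∑ i, (hgradP a b x y i * bUp a b i x
        + kropinaP a b x y * ∑ j, (a x)⁻¹ i j * db a b j i x
        - hgradC a b x y i * sMixed0 a b i x y
        - kropinaC a b x y * ∑ j, covMixed a (sMixed a b) i j i x * y j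
        - hgradQ a b x y i * y i)
      = hgradP a b x y ⬝ᵥ (bUp a b · x) + kropinaP a b x y * rTrace a b x
        - hgradC a b x y ⬝ᵥ (sMixed0 a b · x y) - kropinaC a b x y * sDiv0 a b x y
        - hgradQ a b x y ⬝ᵥ y.ofLp := by
    rw [← h.sum_inv_mul_db hx]
    simp only [Finset.sum_sub_distrib, Finset.sum_add_distrib, ← Finset.mul_sum, sDiv0,
      dotProduct]
  have e2 : ∑ k, hgradD a b x y k * y k = hgradD a b x y ⬝ᵥ y.ofLp := rfl
  have e3 : ∑ m, kropinaH a b m x y * vgradD a b x y m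
      = kropinaP a b x y * (vgradD a b x y ⬝ᵥ (bUp a b · x))
        - kropinaC a b x y * (vgradD a b x y ⬝ᵥ (sMixed0 a b · x y))
        - kropinaQ a b x y * (vgradD a b x y ⬝ᵥ y.ofLp) := by
    simp only [kropinaH, dotProduct, Finset.mul_sum, ← Finset.sum_sub_distrib]
    exact Finset.sum_congr rfl fun _ _ => by ring
  -- The rank-one parts of `∂Hⁱ/∂yᵐ` come from differentiating the scalars `P`, `C`, `Q`; the matrix
  -- `sⁱ_m` and the identity come from differentiating `sⁱ_0` and `yⁱ`.
  rw [e1, e2, e3, sum_sum_mul_swap (Matrix.of fun i j => sMixed a b i j x) (bUp a b · x)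
    (vgradP a b x y) (sMixed0 a b · x y) (vgradC a b x y) y.ofLp (vgradQ a b x y),
    h.trace_sMixed hx, sMixed_mulVec_y, sMixed_mulVec_bUp]
  have f1 : ∑ k, bUp a b k x * s0Cov a b k x y = (s0Cov a b · x y) ⬝ᵥ (bUp a b · x) :=
    dotProduct_comm _ _
  have f2 : ∑ k, bUp a b k x * r00Cov a b k x y = (r00Cov a b · x y) ⬝ᵥ (bUp a b · x) :=
    dotProduct_comm _ _
  have f3 : ∑ k, s0Cov a b k x y * y k = (s0Cov a b · x y) ⬝ᵥ y.ofLp := rfl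
  have f4 : ∑ k, r00Cov a b k x y * y k = (r00Cov a b · x y) ⬝ᵥ y.ofLp := rfl
  have f5 : ∑ k, r0Cov a b k x y * y k = (r0Cov a b · x y) ⬝ᵥ y.ofLp := rfl
  have f6 : ∑ k, sMixed0 a b k x y * r0k a b k x y
      = (r0k a b · x y) ⬝ᵥ (sMixed0 a b · x y) := dotProduct_comm _ _
  have f7 : ∑ k, sMixed0 a b k x y * rLow a b k x
      = (rLow a b · x) ⬝ᵥ (sMixed0 a b · x y) := dotProduct_comm _ _
  have f8 : ∑ k, sMixed0 a b k x y * sLow a b k x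
      = (sLow a b · x) ⬝ᵥ (sMixed0 a b · x y) := dotProduct_comm _ _
  have f9 : ∑ k, sUp a b k x * sLow a b k x = (sLow a b · x) ⬝ᵥ (sUp a b · x) :=
    dotProduct_comm _ _
  have f10 : ∑ k, sUp a b k x * r0k a b k x y = (r0k a b · x y) ⬝ᵥ (sUp a b · x) :=
    dotProduct_comm _ _
  simp only [kropinaT, f1, f2, f3, f4, f5, f6, f7, f8, f9, f10]
  simp only [hgradP, hgradC, hgradQ, hgradD, vgradP, vgradC, vgradQ, vgradD, gradP, gradQ, gradC,
    gradD, dotProduct_neg, add_dotProduct, sub_dotProduct, smul_dotProduct, smul_eq_mul,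
    zero_dotProduct, h.dotProduct_yLow_bUp hx, h.dotProduct_yLow_sMixed0 hx, dotProduct_y_yLow,
    dotProduct_b_bUp, h.dotProduct_b_sMixed0 hx, dotProduct_b_y, dotProduct_sLow_bUp,
    dotProduct_sLow_y, dotProduct_rLow_bUp, dotProduct_rLow_y, dotProduct_r0k_bUp,
    dotProduct_r0k_y, dotProduct_si0_y, dotProduct_si0_bUp, h.dotProduct_yLow_sUp hx,
    h.dotProduct_b_sUp hx, h.dotProduct_yLow_sMixed_mulVec hx, h.dotProduct_b_sMixed_mulVec hx,
    kropinaD, kropinaQ, kropinaP, kropinaC, of_apply]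
  -- The contractions that do not reduce further become independent variables. The claim is then a
  -- rational identity with denominators `α²`, `β`, `b²`, all nonzero; the dimension too is only a
  -- variable.
  generalize (s0Cov a b · x y) ⬝ᵥ (bUp a b · x) = X1
  generalize (r00Cov a b · x y) ⬝ᵥ (bUp a b · x) = X2
  generalize (s0Cov a b · x y) ⬝ᵥ y.ofLp = X3
  generalize (r00Cov a b · x y) ⬝ᵥ y.ofLp = X4
  generalize (r0Cov a b · x y) ⬝ᵥ y.ofLp = X5
  generalize (r0k a b · x y) ⬝ᵥ (sMixed0 a b · x y) = X6
  generalize (rLow a b · x) ⬝ᵥ (sMixed0 a b · x y) = X7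
  generalize (sLow a b · x) ⬝ᵥ (sMixed0 a b · x y) = X8
  generalize (sLow a b · x) ⬝ᵥ (sUp a b · x) = X9
  generalize (r0k a b · x y) ⬝ᵥ (sUp a b · x) = X10
  generalize (si0 a b · x y) ⬝ᵥ (sMixed0 a b · x y) = X11
  generalize ∑ j, ∑ k, sMixed a b j k x * sMixed a b k j x = X12
  generalize rTrace a b x = X13
  generalize sDiv0 a b x y = X14
  generalize rScalar a b x = X15
  generalize r0 a b x y = X16
  generalize r00 a b x y = X17
  generalize s0 a b x y = X18
  generalize alphaSq a x y = A at *
  generalize beta b x y = B at *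
  generalize bSq a b x = b2 at *
  generalize (n : ℝ) = N
  clear e1 e2 e3 f1 f2 f3 f4 f5 f6 f7 f8 f9 f10
  field_simp
  ring

end IsMetricOn

/-- The Ricci curvature of a Kropina metric, in coordinates. -/
theorem ricci_kropina_eq (h : IsMetricOn U a) (hb : IsFormOn U b) {F G : Coord n → Coord n → ℝ}
    (hF : ∀ x ∈ U, ∀ y, energy F x y = (alphaSq a x y / beta b x y) ^ 2)
    (hG : ∀ x ∈ U, ∀ y, energy G x y = alphaSq a x y)
    (hx : x ∈ U) (hy : 0 < beta b x y) :
    ricci F x y = ricci G x y + kropinaT a b x y := by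
  have hW := isOpen_kropinaDomain h.isOpen hb
  have hWU : ∀ p ∈ kropinaDomain U b, p.1 ∈ U := fun p hp => hp.1
  have hp : (x, y) ∈ kropinaDomain U b := ⟨hx, hy⟩
  have hS := smoothOn_riemannSpray h hWU
  have hH := h.smoothOn_kropinaH hb
  rw [ricci_eq_sprayRicci hW (X := fun i x y => riemannSpray a i x y + kropinaH a b i x y)
      (fun i => (hS i).add (hH i))
      (fun i x y hq => geodesicCoeff_kropina h hb (fun x y hq => hF x hq.1 y) i hq) hp,
    ricci_eq_sprayRicci hW hS
      (fun i x y hq => geodesicCoeff_riemannian h hW hWU (fun x y hq => hG x hq.1 y) i hq) hp,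
    sprayRicci_add h hW hWU hH (fun x y hq => h.vdiv_kropinaH hb hq) hp
      (h.kropinaH_hdir hb hp) (h.kropinaH_vdir hb hp) (h.kropinaD_hdir hb hp)
      (h.kropinaD_vdir hb hp), h.kropinaT_eq hp]

end RicciKropina

/-! ### From the manifold to a chart -/

section Charts

variable {n : ℕ} {M : Type*} [TopologicalSpace M] [ChartedSpace (Coord n) M]
  [IsManifold (𝓡 n) ∞ M] {e : OpenPartialHomeomorph M (Coord n)} {x : Coord n}

omit [IsManifold (𝓡 n) ∞ M] in
lemma chartVec_eq_sum (e : OpenPartialHomeomorph M (Coord n)) (x y : Coord n) :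
    chartVec e x y = ∑ i, y i • chartVec e x (unitVec i) := by
  have hy : y = ∑ i, y i • (unitVec i : Coord n) := by
    ext j
    simp [Pi.single_apply]
  calc chartVec e x y = chartVec e x (∑ i, y i • (unitVec i : Coord n)) := by rw [← hy]
    _ = ∑ i, y i • chartVec e x (unitVec i) := by
      simp only [chartVec]
      exact (map_sum (mfderiv (𝓡 n) (𝓡 n) e.symm x) _ _).trans
        (Finset.sum_congr rfl fun i _ => map_smul _ _ _)

omit [IsManifold (𝓡 n) ∞ M] in
lemma mdifferentiable_of_mem_maximalAtlas (he : e ∈ IsManifold.maximalAtlas (𝓡 n) ∞ M) :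
    e.MDifferentiable (𝓡 n) (𝓡 n) :=
  ⟨(contMDiffOn_of_mem_maximalAtlas he).mdifferentiableOn (by simp),
    (contMDiffOn_symm_of_mem_maximalAtlas he).mdifferentiableOn (by simp)⟩

omit [IsManifold (𝓡 n) ∞ M] in
-- The inverse of a smooth chart has injective differential; this transfers positive definiteness to
-- the components.
lemma chartVec_ne_zero (he : e ∈ IsManifold.maximalAtlas (𝓡 n) ∞ M) (hx : x ∈ e.target)
    {y : Coord n} (hy : y ≠ 0) : chartVec e x y ≠ 0 := fun h0 =>
  hy ((mdifferentiable_of_mem_maximalAtlas he).symm.mfderiv_injective hx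
    (h0.trans (map_zero (mfderiv (𝓡 n) (𝓡 n) e.symm x)).symm))

/-- The field is the image of a constant vector field under the tangent map of the inverse chart,
and that map is smooth. -/
lemma contMDiffOn_chartVec (he : e ∈ IsManifold.maximalAtlas (𝓡 n) ∞ M) (u : Coord n) :
    ContMDiffOn (𝓡 n) (𝓡 n).tangent ∞
      (fun x => Bundle.TotalSpace.mk' (Coord n) (E := (TangentSpace (𝓡 n) : M → Type))
        (e.symm x) (chartVec e x u)) e.target := by
  have : IsManifold (𝓡 n) 1 M := IsManifold.of_le (n := ∞) (by simp)
  have h1 := (contMDiffOn_symm_of_mem_maximalAtlas he).contMDiffOn_tangentMapWithin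
    (m := ∞) (by simp) e.open_target.uniqueMDiffOn
  have h2 : ContMDiffOn (𝓡 n) (𝓡 n).tangent ∞
      (fun x : Coord n => (⟨x, u⟩ : TangentBundle (𝓡 n) (Coord n))) e.target :=
    (contMDiffOn_vectorSpace_iff_contDiffOn (V := fun _ => u)).2 contDiffOn_const
  refine (h1.comp h2 fun x hx => hx).congr fun x hx => ?_
  simp only [Function.comp, tangentMapWithin, chartVec,
    mfderivWithin_of_isOpen e.open_target hx]

lemma isFormOn_formComp {β : (p : M) → TangentSpace (𝓡 n) p →L[ℝ] ℝ}
    (hβ : ContMDiff (𝓡 n) ((𝓡 n).prod 𝓘(ℝ, Coord n →L[ℝ] ℝ)) ∞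
      (fun p => Bundle.TotalSpace.mk' (Coord n →L[ℝ] ℝ)
        (E := fun p : M => TangentSpace (𝓡 n) p →L[ℝ] Bundle.Trivial M ℝ p) p (β p)))
    (he : e ∈ IsManifold.maximalAtlas (𝓡 n) ∞ M) : IsFormOn e.target (formComp e β) := by
  intro i
  rw [← contMDiffOn_iff_contDiffOn]
  have hb := hβ.comp_contMDiffOn (contMDiffOn_symm_of_mem_maximalAtlas he)
  have := ContMDiffOn.clm_bundle_apply (F₁ := Coord n) (F₂ := ℝ)
    (E₂ := fun p : M => Bundle.Trivial M ℝ p) hb (contMDiffOn_chartVec he (unitVec i))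
  intro x hx
  have h := this x hx
  -- The pairing is a smooth map into the trivial line bundle; its fibre component is the desired
  -- real function.
  rw [Bundle.contMDiffWithinAt_totalSpace] at h
  exact h.2

lemma contDiffOn_metricComp (g : SmoothMetric n M)
    (he : e ∈ IsManifold.maximalAtlas (𝓡 n) ∞ M) (i j : Fin n) :
    ContDiffOn ℝ ∞ (fun x => metricComp e g x i j) e.target := by
  rw [← contMDiffOn_iff_contDiffOn]
  have hb := g.contMDiff.comp_contMDiffOn (contMDiffOn_symm_of_mem_maximalAtlas he)
  have := ContMDiffOn.clm_bundle_apply₂ (F₁ := Coord n) (F₂ := Coord n) (F₃ := ℝ)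
    (E₃ := fun p : M => Bundle.Trivial M ℝ p) hb (contMDiffOn_chartVec he (unitVec i))
    (contMDiffOn_chartVec he (unitVec j))
  intro x hx
  have h := this x hx
  rw [Bundle.contMDiffWithinAt_totalSpace] at h
  exact h.2

lemma inner_chartVec (g : SmoothMetric n M) (e : OpenPartialHomeomorph M (Coord n))
    (x y : Coord n) : g.inner (e.symm x) (chartVec e x y) (chartVec e x y)
      = alphaSq (metricComp e g) x y := by
  rw [chartVec_eq_sum e x y]
  simp only [map_sum, map_smul, _root_.sum_apply, _root_.smul_apply, smul_eq_mul,
    alphaSq, metricComp, Matrix.of_apply, Finset.mul_sum]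
  rw [Finset.sum_comm]
  exact Finset.sum_congr rfl fun _ _ => Finset.sum_congr rfl fun _ _ => by ring

omit [IsManifold (𝓡 n) ∞ M] in
lemma form_chartVec (β : (p : M) → TangentSpace (𝓡 n) p →L[ℝ] ℝ)
    (e : OpenPartialHomeomorph M (Coord n)) (x y : Coord n) :
    β (e.symm x) (chartVec e x y) = beta (formComp e β) x y := by
  rw [chartVec_eq_sum e x y]
  simp only [map_sum, map_smul, smul_eq_mul, beta, formComp]
  exact Finset.sum_congr rfl fun _ _ => by ring

lemma isMetricOn_metricComp (g : SmoothMetric n M)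
    (he : e ∈ IsManifold.maximalAtlas (𝓡 n) ∞ M) : IsMetricOn e.target (metricComp e g) where
  isOpen := e.open_target
  smooth := contDiffOn_metricComp g he
  symm x _ i j := g.symm _ _ _
  pos x hx v hv := by
    have h1 := inner_chartVec g e x (WithLp.toLp 2 v)
    have h2 := g.pos _ _ (chartVec_ne_zero he hx (y := WithLp.toLp 2 v)
      fun h => hv (by simpa using h))
    rwa [h1, ← dotProduct_y_yLow, dotProduct_comm] at h2

lemma inner_self_nonneg (g : SmoothMetric n M) (p : M) (v : TangentSpace (𝓡 n) p) :
    0 ≤ g.inner p v v := by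
  by_cases hv : v = 0
  · simp [hv]
  · exact (g.pos p v hv).le

lemma riemannianNorm_sq (g : SmoothMetric n M) (e : OpenPartialHomeomorph M (Coord n))
    (x y : Coord n) : riemannianNorm g (e.symm x) (chartVec e x y) ^ 2
      = alphaSq (metricComp e g) x y := by
  rw [riemannianNorm, Real.sq_sqrt (inner_self_nonneg g _ _), inner_chartVec]

end Charts

end Finsler

end

theorem proposition2p2 {n : ℕ} {M : Type*} [TopologicalSpace M]
    [ChartedSpace (Finsler.Coord n) M] [IsManifold (𝓡 n) ∞ M]
    (g : Finsler.SmoothMetric n M)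
    (β : (p : M) → TangentSpace (𝓡 n) p →L[ℝ] ℝ)
    (hβ : ContMDiff (𝓡 n) ((𝓡 n).prod 𝓘(ℝ, Finsler.Coord n →L[ℝ] ℝ)) ∞
      (fun p => Bundle.TotalSpace.mk' (Finsler.Coord n →L[ℝ] ℝ)
        (E := fun p : M => TangentSpace (𝓡 n) p →L[ℝ] Bundle.Trivial M ℝ p) p (β p)))
    (e : OpenPartialHomeomorph M (Finsler.Coord n))
    (he : e ∈ IsManifold.maximalAtlas (𝓡 n) ∞ M)
    (x : Finsler.Coord n) (hx : x ∈ e.target) (y : Finsler.Coord n)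
    (hy : 0 < β (e.symm x) (Finsler.chartVec e x y)) :
    Finsler.ricci (Finsler.inChart e (Finsler.kropinaMetric g β)) x y =
      Finsler.ricci (Finsler.inChart e (Finsler.riemannianNorm g)) x y +
        Finsler.kropinaT (Finsler.metricComp e g) (Finsler.formComp e β) x y := by

  rw [Finsler.form_chartVec] at hy
  -- Only the squares `F²` and `α²` have to be identified. Both identities are algebraic and hold
  -- for every `y`, also where `β ≤ 0`, so no domain condition arises here.
  refine Finsler.ricci_kropina_eq (Finsler.isMetricOn_metricComp g he)
    (Finsler.isFormOn_formComp hβ he) (fun x _ y => ?_) (fun x _ y => ?_) hx hy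
  · rw [Finsler.energy, Finsler.inChart, Finsler.kropinaMetric, Finsler.riemannianNorm_sq,
      Finsler.form_chartVec]
  · rw [Finsler.energy, Finsler.inChart, Finsler.riemannianNorm_sq]
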